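/- There is an absolute constant $C>0$ such that the following holds. Let $g:\mathbb{N}\to\mathbb{R}$ be any function with $g(k)=o(k/\log k)$ as $k\to\infty$ (where $\log$ is the natural logarithm). Then there is $k_0=k_0(g)$ such that for every integer $k\ge k_0$, every integer $q\ge 0$ with $q\le k/(\log k)^2$, and every simple graph $G=(V,E)$ on $k$ vertices with minimum degree at least $k-g(k)$, the following is true. Consider the $(1:q)$ Maker–Breaker game with board $E$: two players, Breaker and Maker, alternately claim previously unclaimed edges of $G$, with Breaker going first; in each turn Breaker claims $q$ edges and Maker claims one edge (a player claims all remaining edges if fewer than his quota are left). Then Maker has a strategy that ensures, against any play of Breaker, that after at most $C\,k(\log k)^2$ moves of Maker the edges claimed by Maker contain all edges of a Hamilton connected graph with vertex set $V$, that is, a graph in which any two distinct vertices are the endpoints of a Hamilton path. -/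

import Mathlib

/-! Biased Maker-Breaker games on a finite board, Breaker moving first. -/

namespace MakerBreaker

variable {α : Type*} [DecidableEq α]

/-- A play is recorded by two sequences: `b i` and `m i` are the sets of elements that Breaker and
Maker claim in round `i = 0, 1, 2, …`. The elements that a player claims in rounds `0, …, n - 1`. -/
def claimed (s : ℕ → Finset α) (n : ℕ) : Finset α :=
  (Finset.range n).biUnion s

/-- A legal turn of a player with bias `p` when `free` is the set of unclaimed elements: he claims
exactly `p` free elements, or all of them if fewer than `p` are left. -/
def IsLegalTurn (p : ℕ) (free S : Finset α) : Prop :=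
  S ⊆ free ∧ S.card = min p free.card

/-- Breaker's turn in round `n` is legal. Both players have completed rounds `0, …, n - 1`. -/
def BreakerLegal (q : ℕ) (X : Finset α) (b m : ℕ → Finset α) (n : ℕ) : Prop :=
  IsLegalTurn q (X \ (claimed b n ∪ claimed m n)) (b n)

/-- Maker's turn in round `n` is legal. Breaker has already played his turn of round `n`. -/
def MakerLegal (p : ℕ) (X : Finset α) (b m : ℕ → Finset α) (n : ℕ) : Prop :=
  IsLegalTurn p (X \ (claimed b (n + 1) ∪ claimed m n)) (m n)

/-- A strategy of Maker: his next turn as a function of the list of all completed rounds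
(pairs of Breaker's turn and Maker's turn) and of Breaker's turn in the current round. -/
abbrev MakerStrategy (α : Type*) : Type _ :=
  List (Finset α × Finset α) → Finset α → Finset α

/-- In the play `b, m`, Maker plays according to the strategy `σ`. -/
def Follows (σ : MakerStrategy α) (b m : ℕ → Finset α) : Prop :=
  ∀ n, m n = σ ((List.range n).map fun i => (b i, m i)) (b n)

/-- In the `(p : q)` game with board `X` and family of winning sets `F`, Maker has a strategy that
wins within `t` moves (turns) of Maker: whatever legal turns Breaker plays, after some number
`n ≤ t` of turns, all of them legal, Maker has claimed all elements of some winning set. -/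
def MakerWinsWithin (p q : ℕ) (X : Finset α) (F : Set (Finset α)) (t : ℕ) : Prop :=
  ∃ σ : MakerStrategy α, ∀ b m : ℕ → Finset α,
    (∀ n, BreakerLegal q X b m n) → Follows σ b m →
      ∃ n ≤ t, (∀ i < n, MakerLegal p X b m i) ∧ ∃ A ∈ F, A ⊆ claimed m n

end MakerBreaker

/-- Any two distinct vertices are the endpoints of a Hamilton path. -/
def SimpleGraph.IsHamiltonConnected {V : Type*} [DecidableEq V] (G : SimpleGraph V) : Prop :=
  ∀ u w : V, u ≠ w → ∃ P : G.Walk u w, P.IsHamiltonian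

/-- The edge sets of the Hamilton connected spanning subgraphs of `G`. -/
def SimpleGraph.hamiltonConnectedEdgeSets {V : Type*} [Fintype V] [DecidableEq V]
    (G : SimpleGraph V) [DecidableRel G.Adj] : Set (Finset (Sym2 V)) :=
  {A | A ⊆ G.edgeFinset ∧ (SimpleGraph.fromEdgeSet (A : Set (Sym2 V))).IsHamiltonConnected}

/-!
Maker plays in two stages, and in each stage he has to hit every set of a family of edge sets. For
this the biased Erdős–Selfridge criterion (`MakerBreaker.canReach_hitsAll`) suffices: if
`∑ 2 ^ (-|A| / Q) < 1 / 2`, then Maker hits all sets `A` against any bias `q ≤ Q`. Maker pretends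
that Breaker takes `Q` elements in each round, so he is done as soon as the board would be used
up, however small `q` is. Here `Q` is about `1024 k / (log k) ^ 2`, so a board of at most `k ^ 2`
edges lasts for at most about `k (log k) ^ 2 / 1024` rounds, and in the first stage Breaker really
takes no more than `k ^ 2 / 512` edges.

In the first stage Maker hits all edge sets `E(S, V \ U)` with `1 ≤ |S| ≤ k / 8`, `S ⊆ U` and
`|U| = 6 |S| + 2`. For each `S` there are at most `k ^ (8 |S|)` sets `U`, while each of the edge
sets has at least `|S| k / 256` elements and so has weight at most `k ^ (-10 |S|)`; the sum of
`k ^ (-2 |S|)` over all nonempty `S` is below `1 / 2`. Afterwards Maker's graph `Γ₀` is connected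
and every `S` with `|S| ≤ k / 8` has at least `5 |S| + 3` outer neighbours.

In the second stage let `Γ` arise from `Γ₀` by adding at most `k` edges, and let `u ≠ w`. Consider
the paths of `Γ + uw` that use the edge `uw`. Pósa rotations of a longest such path which keep
`uw` (`SimpleGraph.card_outerNeighbors_rotationEnds_le`) show that `Γ` has at least `k ^ 2 / 128`
boosters (`SimpleGraph.IsExpanding.card_boosters`), that is, edges whose addition gives a longer
such path or a Hamilton path from `u` to `w`. At least `k ^ 2 / 256` boosters are edges of `G`
that Breaker has not taken in the first stage. There are at most `k ^ (4 k)` triples `(Γ, u, w)`,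
because `Γ₀` is now fixed, and each booster set has weight at most `k ^ (-10 k)`, so Maker can hit
all of them. Adding boosters among Maker's edges one by one then leads to a Hamilton path from `u`
to `w` (`SimpleGraph.exists_isHamiltonian_of_boosters`), for all pairs `u, w` at once.
-/

/-! ### Winning positions and the biased Erdős–Selfridge criterion -/

namespace MakerBreaker

variable {α : Type*} [DecidableEq α]

/-- Maker, who claims one element per turn, can force a position `(B, M)` with `W B M` within `t`
rounds, where `B` and `M` are the elements claimed so far by Breaker (bias `q`, to move) and
Maker. -/
def CanReach (q : ℕ) (X : Finset α) (W : Finset α → Finset α → Prop) :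
    ℕ → Finset α → Finset α → Prop
  | 0, B, M => W B M
  | t + 1, B, M => W B M ∨ ∀ S, IsLegalTurn q (X \ (B ∪ M)) S →
      ∃ T, IsLegalTurn 1 (X \ (B ∪ S ∪ M)) T ∧ CanReach q X W t (B ∪ S) (M ∪ T)

theorem CanReach.of_target {q : ℕ} {X : Finset α} {W : Finset α → Finset α → Prop} (t : ℕ)
    {B M : Finset α} (h : W B M) : CanReach q X W t B M := by
  cases t with
  | zero => exact h
  | succ t => exact Or.inl h

theorem CanReach.mono_time {q : ℕ} {X : Finset α} {W : Finset α → Finset α → Prop} {s t : ℕ}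
    (hst : s ≤ t) {B M : Finset α} (h : CanReach q X W s B M) : CanReach q X W t B M := by
  induction t generalizing s B M with
  | zero => rwa [Nat.le_zero.1 hst] at h
  | succ t ih =>
    cases s with
    | zero => exact Or.inl h
    | succ s =>
      rcases h with h | h
      · exact Or.inl h
      · refine Or.inr fun S hS => ?_
        obtain ⟨T, hT, h'⟩ := h S hS
        exact ⟨T, hT, ih (Nat.le_of_succ_le_succ hst) h'⟩

theorem CanReach.trans {q : ℕ} {X : Finset α} {W W' : Finset α → Finset α → Prop} {s t : ℕ}
    (hW : ∀ B M, W B M → CanReach q X W' t B M) {B M : Finset α} (h : CanReach q X W s B M) :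
    CanReach q X W' (s + t) B M := by
  induction s generalizing B M with
  | zero => simpa using hW B M h
  | succ s ih =>
    rcases h with h | h
    · exact (hW B M h).mono_time (by omega)
    · rw [Nat.succ_add]
      refine Or.inr fun S hS => ?_
      obtain ⟨T, hT, h'⟩ := h S hS
      exact ⟨T, hT, ih h'⟩

theorem CanReach.and_subset {q : ℕ} {X : Finset α} {W : Finset α → Finset α → Prop} {t : ℕ}
    {M₀ B M : Finset α} (hM : M₀ ⊆ M) (h : CanReach q X W t B M) :
    CanReach q X (fun B M => W B M ∧ M₀ ⊆ M) t B M := by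
  induction t generalizing B M with
  | zero => exact ⟨h, hM⟩
  | succ t ih =>
    rcases h with h | h
    · exact Or.inl ⟨h, hM⟩
    · refine Or.inr fun S hS => ?_
      obtain ⟨T, hT, h'⟩ := h S hS
      exact ⟨T, hT, ih (hM.trans Finset.subset_union_left) h'⟩

theorem claimed_zero (s : ℕ → Finset α) : claimed s 0 = ∅ := by simp [claimed]

theorem claimed_succ (s : ℕ → Finset α) (n : ℕ) : claimed s (n + 1) = claimed s n ∪ s n := by
  rw [claimed, Finset.range_add_one, Finset.biUnion_insert, Finset.union_comm, claimed]

/-- Maker's strategy of staying in positions from which the target can be reached. -/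
noncomputable def reachStrategy (q : ℕ) (X : Finset α) (W : Finset α → Finset α → Prop) (t : ℕ) :
    MakerStrategy α := fun h S =>
  let B := (h.map Prod.fst).foldr (· ∪ ·) ∅
  let M := (h.map Prod.snd).foldr (· ∪ ·) ∅
  Classical.epsilon fun T => IsLegalTurn 1 (X \ (B ∪ S ∪ M)) T ∧
    CanReach q X W (t - h.length - 1) (B ∪ S) (M ∪ T)

theorem foldr_union_map_range (s : ℕ → Finset α) (n : ℕ) :
    ((List.range n).map s).foldr (· ∪ ·) ∅ = claimed s n := by
  ext x
  have : ∀ l : List (Finset α), x ∈ l.foldr (· ∪ ·) ∅ ↔ ∃ A ∈ l, x ∈ A := by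
    intro l
    induction l with
    | nil => simp
    | cons A l ih => simp [ih]
  simp [this, claimed]

/-- A target that can be reached from the starting position is won by a strategy in the sense of
`MakerWinsWithin`. -/
theorem CanReach.makerWinsWithin {q : ℕ} {X : Finset α} {W : Finset α → Finset α → Prop} {t : ℕ}
    {F : Set (Finset α)} (h : CanReach q X W t ∅ ∅)
    (hWF : ∀ B M, W B M → ∃ A ∈ F, A ⊆ M) : MakerWinsWithin 1 q X F t := by
  refine ⟨reachStrategy q X W t, fun b m hb hm => ?_⟩
  have key : ∀ n ≤ t, (∃ n' ≤ n, (∀ i < n', MakerLegal 1 X b m i) ∧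
      W (claimed b n') (claimed m n')) ∨ ((∀ i < n, MakerLegal 1 X b m i) ∧
      CanReach q X W (t - n) (claimed b n) (claimed m n)) := by
    intro n
    induction n with
    | zero =>
      intro _
      exact Or.inr ⟨by simp, by simpa [claimed_zero] using h⟩
    | succ n ih =>
      intro hn
      rcases ih (by omega) with ⟨n', hn', hl, hW⟩ | ⟨hl, hR⟩
      · exact Or.inl ⟨n', by omega, hl, hW⟩
      · obtain ⟨u, hu⟩ : ∃ u, t - n = u + 1 := ⟨t - n - 1, by omega⟩
        rw [hu] at hR
        rcases hR with hW | hR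
        · exact Or.inl ⟨n, by omega, hl, hW⟩
        · have hex := hR (b n) (hb n)
          have hmn := hm n
          have hu' : t - n - 1 = u := by omega
          simp only [reachStrategy, List.map_map, Function.comp_def, foldr_union_map_range,
            List.length_map, List.length_range, hu'] at hmn
          have hs := Classical.epsilon_spec hex
          rw [← hmn] at hs
          refine Or.inr ⟨fun i hi => ?_, ?_⟩
          · rcases Nat.lt_succ_iff_lt_or_eq.1 hi with hi | rfl
            · exact hl i hi
            · rw [MakerLegal, claimed_succ]
              exact hs.1
          · rw [claimed_succ, claimed_succ, show t - (n + 1) = u by omega]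
            exact hs.2
  rcases key t le_rfl with ⟨n, hn, hl, hW⟩ | ⟨hl, hR⟩
  · exact ⟨n, hn, hl, hWF _ _ hW⟩
  · rw [Nat.sub_self] at hR
    exact ⟨t, le_rfl, hl, hWF _ _ hR⟩

variable {ι : Type*}

/-- The Erdős–Selfridge potential of the sets `A i` that Maker (holding `M`) has not hit yet, when
the elements of `D` are lost for Maker: a set with `r` elements outside `D` has weight
`2 ^ (-r / Q)`. -/
noncomputable def potential (Q : ℕ) (I : Finset ι) (A : ι → Finset α) (D M : Finset α) : ℝ :=
  ∑ i ∈ I with Disjoint (A i) M, (2 : ℝ) ^ (-(((A i \ D).card : ℝ) / Q))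

/-- The part of the potential that comes from the sets containing `e`. -/
noncomputable def danger (Q : ℕ) (I : Finset ι) (A : ι → Finset α) (D M : Finset α) (e : α) : ℝ :=
  ∑ i ∈ I with Disjoint (A i) M ∧ e ∈ A i, (2 : ℝ) ^ (-(((A i \ D).card : ℝ) / Q))

theorem potential_insert_add_danger (Q : ℕ) (I : Finset ι) (A : ι → Finset α) (D M : Finset α)
    (e : α) : potential Q I A D (M ∪ {e}) + danger Q I A D M e = potential Q I A D M := by
  rw [potential, danger, potential,
    ← Finset.sum_filter_add_sum_filter_not (I.filter fun i => Disjoint (A i) M)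
      (fun i => e ∉ A i), Finset.filter_filter, Finset.filter_filter]
  simp only [Finset.disjoint_union_right, Finset.disjoint_singleton_right, not_not]

theorem danger_insert_le (Q : ℕ) (I : Finset ι) (A : ι → Finset α) (D M : Finset α) (e y : α) :
    danger Q I A D (M ∪ {e}) y ≤ danger Q I A D M y := by
  refine Finset.sum_le_sum_of_subset_of_nonneg ?_ fun _ _ _ => by positivity
  intro i
  simp only [Finset.mem_filter, Finset.disjoint_union_right]
  tauto

/-- Losing at most `Q` elements raises the potential by at most the average of `Q` dangers, because
`2 ^ (j / Q) ≤ 1 + j / Q` for `j ≤ Q`. -/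
theorem potential_union_le {Q : ℕ} (hQ : 0 < Q) (I : Finset ι) (A : ι → Finset α)
    (D M Y : Finset α) (hY : Y.card ≤ Q) (hYD : Disjoint Y D) :
    potential Q I A (D ∪ Y) M ≤ potential Q I A D M + (∑ y ∈ Y, danger Q I A D M y) / Q := by
  have hQ' : (0 : ℝ) < Q := by exact_mod_cast hQ
  have h1 : ∑ y ∈ Y, danger Q I A D M y = ∑ i ∈ I with Disjoint (A i) M,
      ((A i ∩ Y).card : ℝ) * (2 : ℝ) ^ (-(((A i \ D).card : ℝ) / Q)) := by
    simp only [danger, ← Finset.filter_filter]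
    simp only [Finset.sum_filter (p := fun i => _ ∈ A i)]
    rw [Finset.sum_comm]
    refine Finset.sum_congr rfl fun i _ => ?_
    rw [← Finset.sum_filter, Finset.sum_const, nsmul_eq_mul, Finset.filter_mem_eq_inter,
      Finset.inter_comm]
  rw [h1, Finset.sum_div, potential, potential, ← Finset.sum_add_distrib]
  refine Finset.sum_le_sum fun i _ => ?_
  set j := (A i ∩ Y).card with hj
  have hcard : (A i \ D).card = (A i \ (D ∪ Y)).card + j := by
    rw [← Finset.card_sdiff_add_card_inter (A i \ D) Y, hj, Finset.sdiff_sdiff_left']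
    congr 2
    · ext x; simp only [Finset.mem_inter, Finset.mem_sdiff, Finset.mem_union]; tauto
    · ext x
      simp only [Finset.mem_inter, Finset.mem_sdiff]
      exact ⟨fun h => ⟨h.1.1, h.2⟩, fun h => ⟨⟨h.1, Finset.disjoint_left.1 hYD h.2⟩, h.2⟩⟩
  have hjQ : j ≤ Q := (Finset.card_le_card Finset.inter_subset_right).trans hY
  have hbern : (2 : ℝ) ^ ((j : ℝ) / Q) ≤ 1 + (j : ℝ) / Q := by
    have := rpow_one_add_le_one_add_mul_self (s := 1) (by norm_num) (p := (j : ℝ) / Q)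
      (by positivity) (by rw [div_le_one hQ']; exact_mod_cast hjQ)
    norm_num at this
    linarith
  have hsplit : (2 : ℝ) ^ (-(((A i \ (D ∪ Y)).card : ℝ) / Q)) =
      (2 : ℝ) ^ (-(((A i \ D).card : ℝ) / Q)) * (2 : ℝ) ^ ((j : ℝ) / Q) := by
    rw [← Real.rpow_add (by norm_num), hcard]
    congr 1
    push_cast
    ring
  rw [hsplit]
  have h2 : (0 : ℝ) < (2 : ℝ) ^ (-(((A i \ D).card : ℝ) / Q)) := by positivity
  calc _ ≤ (2 : ℝ) ^ (-(((A i \ D).card : ℝ) / Q)) * (1 + (j : ℝ) / Q) :=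
        mul_le_mul_of_nonneg_left hbern h2.le
    _ = _ := by ring

theorem one_le_potential {Q : ℕ} {I : Finset ι} {A : ι → Finset α} {D M : Finset α} {i : ι}
    (hi : i ∈ I) (hM : Disjoint (A i) M) (hD : A i ⊆ D) : 1 ≤ potential Q I A D M := by
  have : (2 : ℝ) ^ (-(((A i \ D).card : ℝ) / Q)) = 1 := by
    simp [Finset.sdiff_eq_empty_iff_subset.2 hD]
  rw [← this]
  exact Finset.single_le_sum (f := fun i => (2 : ℝ) ^ (-(((A i \ D).card : ℝ) / Q)))
    (fun _ _ => by positivity) (by simp [hi, hM])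

/-- The position that Maker aims for: every `A i` is hit, and Breaker has at most `β` elements. -/
def HitsAll (X : Finset α) (I : Finset ι) (A : ι → Finset α) (β : ℕ) (B M : Finset α) : Prop :=
  (∀ i ∈ I, ¬ Disjoint (A i) M) ∧ B.card ≤ β ∧ B ⊆ X ∧ M ⊆ X ∧ Disjoint B M

theorem exists_isLegalTurn {β : Type*} (p : ℕ) (free : Finset β) : ∃ T, IsLegalTurn p free T := by
  obtain ⟨T, hT, hc⟩ := Finset.exists_subset_card_eq (min_le_right p free.card)
  exact ⟨T, hT, hc⟩

/-- The inductive form of the biased Erdős–Selfridge strategy. Maker pretends that Breaker owns a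
larger set `D` which grows by exactly `Q ≥ q` elements in each round, so that the whole board is
used up after `n` rounds as soon as `|X| ≤ |D| + |M| + n (Q + 1)`. Before each turn of Breaker the
potential is below `1`, whichever `Q` elements are lost next. -/
theorem canReach_hitsAll_aux {q Q : ℕ} (hQ : 0 < Q) (hqQ : q ≤ Q) (X : Finset α) (I : Finset ι)
    (A : ι → Finset α) (hA : ∀ i ∈ I, A i ⊆ X) (β n : ℕ) (B M D : Finset α) (hBD : B ⊆ D)
    (hDX : D ⊆ X) (hMX : M ⊆ X) (hDM : Disjoint D M)
    (hcard : X.card ≤ D.card + M.card + n * (Q + 1)) (hβ : B.card + q * n ≤ β)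
    (hpot : ∀ Y ⊆ X \ (D ∪ M), Y.card ≤ Q → potential Q I A (D ∪ Y) M < 1) :
    CanReach q X (HitsAll X I A β) n B M := by
  induction n generalizing B M D with
  | zero =>
    have hX : D ∪ M = X := by
      refine Finset.eq_of_subset_of_card_le (Finset.union_subset hDX hMX) ?_
      rw [Finset.card_union_of_disjoint hDM]
      omega
    refine ⟨fun i hi hd => ?_, by omega, hBD.trans hDX, hMX,
      Finset.disjoint_of_subset_left hBD hDM⟩
    have h1 := hpot ∅ (by simp) (by simp)
    rw [Finset.union_empty] at h1
    refine absurd (one_le_potential hi hd ?_) (not_le.2 h1)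
    intro x hx
    have := hA i hi hx
    rw [← hX, Finset.mem_union] at this
    exact this.resolve_right (Finset.disjoint_left.1 hd hx)
  | succ n ih =>
    refine Or.inr fun S hS => ?_
    have hSsub : S ⊆ X \ (B ∪ M) := hS.1
    have hSq : S.card ≤ q := hS.2.trans_le (min_le_left _ _)
    have hSX : S ⊆ X := hSsub.trans Finset.sdiff_subset
    have hSM : Disjoint S M := by
      refine Finset.disjoint_left.2 fun x hx hxM => ?_
      have := hSsub hx
      simp only [Finset.mem_sdiff, Finset.mem_union, hxM, or_true, not_true, and_false] at this
    have hB'card : (B ∪ S).card + q * n ≤ β := by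
      have := Finset.card_union_le B S
      have h2 : q * (n + 1) = q * n + q := by ring
      omega
    -- the fictitious turn of Breaker: `Z` contains the new elements of `S`
    obtain ⟨Z, hSZ, hZ, hZcard⟩ : ∃ Z, S \ D ⊆ Z ∧ Z ⊆ X \ (D ∪ M) ∧
        Z.card = min Q (X \ (D ∪ M)).card := by
      have h1 : S \ D ⊆ X \ (D ∪ M) := by
        intro x hx
        simp only [Finset.mem_sdiff, Finset.mem_union, not_or] at hx ⊢
        exact ⟨hSX hx.1, hx.2, Finset.disjoint_left.1 hSM hx.1⟩
      exact Finset.exists_subsuperset_card_eq h1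
        (le_min ((Finset.card_le_card Finset.sdiff_subset).trans (hSq.trans hqQ))
          (Finset.card_le_card h1)) (min_le_right _ _)
    have hpotZ := hpot Z hZ (hZcard.trans_le (min_le_left _ _))
    have hZD : Disjoint Z D := by
      refine Finset.disjoint_left.2 fun x hx hxD => ?_
      have := hZ hx
      simp [hxD] at this
    have hZM : Disjoint Z M := by
      refine Finset.disjoint_left.2 fun x hx hxD => ?_
      have := hZ hx
      simp [hxD] at this
    have hBS : B ∪ S ⊆ D ∪ Z := by
      intro x hx
      rcases Finset.mem_union.1 hx with hx | hx
      · exact Finset.mem_union_left _ (hBD hx)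
      · by_cases hxD : x ∈ D
        · exact Finset.mem_union_left _ hxD
        · exact Finset.mem_union_right _ (hSZ (by simp [hx, hxD]))
    have hDZX : D ∪ Z ⊆ X := Finset.union_subset hDX (hZ.trans Finset.sdiff_subset)
    have hDZM : Disjoint (D ∪ Z) M := Finset.disjoint_union_left.2 ⟨hDM, hZM⟩
    by_cases hfull : X \ (D ∪ Z ∪ M) = ∅
    · obtain ⟨T, hT⟩ := exists_isLegalTurn 1 (X \ (B ∪ S ∪ M))
      refine ⟨T, hT, CanReach.of_target _ ⟨fun i hi hd => ?_, by omega, hBS.trans hDZX,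
        Finset.union_subset hMX (hT.1.trans Finset.sdiff_subset), ?_⟩⟩
      · rw [Finset.disjoint_union_right] at hd
        refine absurd (one_le_potential hi hd.1 ?_) (not_le.2 hpotZ)
        intro x hx
        have hx' := (Finset.sdiff_eq_empty_iff_subset.1 hfull) (hA i hi hx)
        exact (Finset.mem_union.1 hx').resolve_right (Finset.disjoint_left.1 hd.1 hx)
      · rw [Finset.disjoint_union_right]
        refine ⟨Finset.disjoint_of_subset_left hBS hDZM, ?_⟩
        refine Finset.disjoint_left.2 fun x hx hxT => ?_
        have := hT.1 hxT
        rw [Finset.mem_sdiff, Finset.mem_union] at this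
        exact this.2 (Or.inl hx)
    · obtain ⟨e, he, hmax⟩ := Finset.exists_max_image (X \ (D ∪ Z ∪ M)) (danger Q I A (D ∪ Z) M)
        (Finset.nonempty_iff_ne_empty.2 hfull)
      have he' := he
      simp only [Finset.mem_sdiff, Finset.mem_union, not_or] at he'
      obtain ⟨heX, ⟨heD, heZ⟩, heM⟩ := he'
      have heB : e ∉ B ∪ S := fun h => (Finset.mem_union.1 (hBS h)).elim heD heZ
      have hefree : e ∈ X \ (B ∪ S ∪ M) := by
        rw [Finset.mem_sdiff, Finset.mem_union]
        exact ⟨heX, not_or.2 ⟨heB, heM⟩⟩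
      refine ⟨{e}, ⟨by simpa using hefree, ?_⟩, ?_⟩
      · rw [Finset.card_singleton, min_eq_left (Finset.card_pos.2 ⟨e, hefree⟩)]
      have hZQ : Z.card = Q := by
        rw [hZcard]
        refine min_eq_left ?_
        by_contra! hlt
        rw [min_eq_right hlt.le] at hZcard
        have hZall := Finset.eq_of_subset_of_card_le hZ hZcard.ge
        refine heZ ?_
        rw [hZall]
        simp [heX, heD, heM]
      refine ih (B ∪ S) (M ∪ {e}) (D ∪ Z) hBS hDZX
        (Finset.union_subset hMX (by simpa using heX)) ?_ ?_ hB'card ?_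
      · rw [Finset.disjoint_union_right]
        exact ⟨hDZM, by simp [heD, heZ]⟩
      · rw [Finset.card_union_of_disjoint hZD.symm,
          Finset.card_union_of_disjoint (by simpa using heM), Finset.card_singleton, hZQ]
        have : (n + 1) * (Q + 1) = n * (Q + 1) + Q + 1 := by ring
        omega
      · intro Y hY hYQ
        have hYD : Disjoint Y (D ∪ Z) := by
          refine Finset.disjoint_left.2 fun x hx hxD => ?_
          have := hY hx
          rw [Finset.mem_sdiff, Finset.mem_union] at this
          exact this.2 (Or.inl hxD)
        have hQ' : (0 : ℝ) < Q := by exact_mod_cast hQ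
        have hsum : ∑ y ∈ Y, danger Q I A (D ∪ Z) (M ∪ {e}) y ≤
            Q * danger Q I A (D ∪ Z) M e := by
          calc ∑ y ∈ Y, danger Q I A (D ∪ Z) (M ∪ {e}) y
              ≤ ∑ _y ∈ Y, danger Q I A (D ∪ Z) M e := by
                refine Finset.sum_le_sum fun y hy => (danger_insert_le _ _ _ _ _ _ _).trans ?_
                refine hmax y ?_
                have := hY hy
                simp only [Finset.mem_sdiff, Finset.mem_union, not_or] at this ⊢
                exact ⟨this.1, this.2.1, this.2.2.1⟩
            _ = Y.card * danger Q I A (D ∪ Z) M e := by rw [Finset.sum_const, nsmul_eq_mul]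
            _ ≤ Q * danger Q I A (D ∪ Z) M e := by
                refine mul_le_mul_of_nonneg_right (by exact_mod_cast hYQ) ?_
                exact Finset.sum_nonneg fun _ _ => by positivity
        calc potential Q I A (D ∪ Z ∪ Y) (M ∪ {e})
            ≤ potential Q I A (D ∪ Z) (M ∪ {e}) +
              (∑ y ∈ Y, danger Q I A (D ∪ Z) (M ∪ {e}) y) / Q :=
              potential_union_le hQ I A _ _ Y hYQ hYD
          _ ≤ potential Q I A (D ∪ Z) (M ∪ {e}) + danger Q I A (D ∪ Z) M e := by
              gcongr
              rw [div_le_iff₀ hQ']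
              linarith
          _ = potential Q I A (D ∪ Z) M := potential_insert_add_danger _ _ _ _ _ _
          _ < 1 := hpotZ

/-- **Biased Erdős–Selfridge criterion.** If the sets `A i` avoid Breaker's elements and
`∑ 2 ^ (-|A i| / Q) < 1 / 2`, then against bias `q ≤ Q` Maker hits all of them within `t` rounds,
provided that `t (Q + 1)` is at least the size of the board. -/
theorem canReach_hitsAll {q Q : ℕ} (hQ : 0 < Q) (hqQ : q ≤ Q) (X : Finset α) (I : Finset ι)
    (A : ι → Finset α) {B M : Finset α} (hA : ∀ i ∈ I, A i ⊆ X \ B) (t : ℕ) (hBX : B ⊆ X)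
    (hMX : M ⊆ X) (hBM : Disjoint B M) (ht : X.card ≤ t * (Q + 1))
    (hsum : ∑ i ∈ I, (2 : ℝ) ^ (-(((A i).card : ℝ) / Q)) < 1 / 2) :
    CanReach q X (HitsAll X I A (B.card + q * t)) t B M := by
  refine canReach_hitsAll_aux hQ hqQ X I A (fun i hi => (hA i hi).trans Finset.sdiff_subset) _ t
    B M B subset_rfl hBX hMX hBM (by omega) le_rfl fun Y _ hYQ => ?_
  have hQ' : (0 : ℝ) < Q := by exact_mod_cast hQ
  calc potential Q I A (B ∪ Y) M
      ≤ ∑ i ∈ I, (2 : ℝ) ^ (-(((A i \ (B ∪ Y)).card : ℝ) / Q)) :=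
        Finset.sum_le_sum_of_subset_of_nonneg (Finset.filter_subset _ _)
          fun _ _ _ => by positivity
    _ ≤ ∑ i ∈ I, 2 * (2 : ℝ) ^ (-(((A i).card : ℝ) / Q)) := by
        refine Finset.sum_le_sum fun i hi => ?_
        have hle : ((A i).card : ℝ) ≤ (A i \ (B ∪ Y)).card + Q := by
          have h1 : A i \ (B ∪ Y) = A i \ Y := by
            ext x
            simp only [Finset.mem_sdiff, Finset.mem_union, not_or]
            exact ⟨fun h => ⟨h.1, h.2.2⟩,
              fun h => ⟨h.1, (Finset.mem_sdiff.1 (hA i hi h.1)).2, h.2⟩⟩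
          have h2 := Finset.card_le_card_sdiff_add_card (s := A i) (t := Y)
          rw [h1]
          exact_mod_cast h2.trans (by omega)
        calc (2 : ℝ) ^ (-(((A i \ (B ∪ Y)).card : ℝ) / Q))
            ≤ (2 : ℝ) ^ (1 + -(((A i).card : ℝ) / Q)) := by
              refine Real.rpow_le_rpow_of_exponent_le (by norm_num) ?_
              have : ((A i).card : ℝ) / Q ≤ ((A i \ (B ∪ Y)).card + Q) / Q := by gcongr
              rw [add_div, div_self hQ'.ne'] at this
              linarith
          _ = 2 * (2 : ℝ) ^ (-(((A i).card : ℝ) / Q)) := by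
              rw [Real.rpow_add (by norm_num), Real.rpow_one]
    _ = 2 * ∑ i ∈ I, (2 : ℝ) ^ (-(((A i).card : ℝ) / Q)) := by rw [Finset.mul_sum]
    _ < 1 := by linarith

end MakerBreaker

/-! ### Pósa rotations of paths through a prescribed pair -/

namespace SimpleGraph

variable {V : Type*}

/-- `a` and `b` are neighbours, in either order, in the list `l`. -/
def Consecutive (l : List V) (a b : V) : Prop :=
  [a, b] <:+: l ∨ [b, a] <:+: l

theorem pair_infix_iff {l : List V} {a b : V} :
    [a, b] <:+: l ↔ ∃ i, l[i]? = some a ∧ l[i + 1]? = some b := by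
  constructor
  · rintro ⟨p, s, rfl⟩
    refine ⟨p.length, ?_, ?_⟩ <;> simp
  · rintro ⟨i, ha, hb⟩
    obtain ⟨hi, ha⟩ := List.getElem?_eq_some_iff.1 ha
    obtain ⟨hi', hb⟩ := List.getElem?_eq_some_iff.1 hb
    refine ⟨l.take i, l.drop (i + 2), ?_⟩
    rw [← ha, ← hb, List.append_assoc]
    simp

theorem pair_infix_append {l₁ l₂ : List V} {a b : V} : [a, b] <:+: l₁ ++ l₂ ↔
    [a, b] <:+: l₁ ∨ [a, b] <:+: l₂ ∨ (a ∈ l₁.getLast? ∧ b ∈ l₂.head?) := by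
  induction l₁ with
  | nil => simp
  | cons x t ih =>
    rw [List.cons_append, List.infix_cons_iff, ih, List.infix_cons_iff (l₂ := t)]
    cases t with
    | nil =>
      cases l₂ with
      | nil => simp
      | cons z l₂ =>
        simp only [List.nil_append, List.cons_prefix_cons, List.nil_prefix, and_true,
          List.prefix_nil, List.cons_ne_nil, and_false, List.infix_nil, or_false, false_or,
          List.getLast?_singleton, List.head?_cons, Option.mem_def, Option.some.injEq,
          List.getLast?_nil, reduceCtorEq, false_and]
        rw [eq_comm (a := a), eq_comm (a := b), or_comm]
    | cons z t =>
      simp only [List.cons_append, List.cons_prefix_cons, List.nil_prefix, and_true,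
        List.getLast?_cons_cons]
      tauto

theorem succ_unique {l : List V} (hl : l.Nodup) {a b c : V} (hb : [a, b] <:+: l)
    (hc : [a, c] <:+: l) : b = c := by
  obtain ⟨i, hi, hi'⟩ := pair_infix_iff.1 hb
  obtain ⟨j, hj, hj'⟩ := pair_infix_iff.1 hc
  obtain ⟨hil, -⟩ := List.getElem?_eq_some_iff.1 hi
  have := (List.getElem?_inj hil hl).1 (hi.trans hj.symm)
  subst this
  exact Option.some_injective _ (hi'.symm.trans hj')

theorem pred_unique {l : List V} (hl : l.Nodup) {a b c : V} (hb : [b, a] <:+: l)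
    (hc : [c, a] <:+: l) : b = c := by
  obtain ⟨i, hi, hi'⟩ := pair_infix_iff.1 hb
  obtain ⟨j, hj, hj'⟩ := pair_infix_iff.1 hc
  obtain ⟨hil, -⟩ := List.getElem?_eq_some_iff.1 hi'
  have := (List.getElem?_inj hil hl).1 (hi'.trans hj'.symm)
  obtain rfl : i = j := by omega
  exact Option.some_injective _ (hi.symm.trans hj)

theorem consecutive_reverse {l : List V} {a b : V} :
    Consecutive l.reverse a b ↔ Consecutive l a b := by
  have h : ∀ x y : V, [x, y] <:+: l.reverse ↔ [y, x] <:+: l := by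
    intro x y
    rw [← List.reverse_infix, List.reverse_reverse]
    simp
  rw [Consecutive, Consecutive, h, h, or_comm]

theorem consecutive_append {l₁ l₂ : List V} {a b : V} : Consecutive (l₁ ++ l₂) a b ↔
    Consecutive l₁ a b ∨ Consecutive l₂ a b ∨
      ∃ x ∈ l₁.getLast?, ∃ y ∈ l₂.head?, s(a, b) = s(x, y) := by
  have h : (∃ x ∈ l₁.getLast?, ∃ y ∈ l₂.head?, s(a, b) = s(x, y)) ↔
      (a ∈ l₁.getLast? ∧ b ∈ l₂.head?) ∨ (b ∈ l₁.getLast? ∧ a ∈ l₂.head?) := by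
    constructor
    · rintro ⟨x, hx, y, hy, h⟩
      rcases Sym2.eq_iff.1 h with ⟨rfl, rfl⟩ | ⟨rfl, rfl⟩
      · exact Or.inl ⟨hx, hy⟩
      · exact Or.inr ⟨hx, hy⟩
    · rintro (⟨ha, hb⟩ | ⟨hb, ha⟩)
      · exact ⟨a, ha, b, hb, rfl⟩
      · exact ⟨b, hb, a, ha, Sym2.eq_swap⟩
  rw [h, Consecutive, Consecutive, Consecutive, pair_infix_append, pair_infix_append]
  tauto

/-- Adjacency in `Γ`, or being the prescribed pair `u, w`. -/
def LinkAdj (Γ : SimpleGraph V) (u w x y : V) : Prop :=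
  Γ.Adj x y ∨ s(x, y) = s(u, w)

theorem LinkAdj.symm {Γ : SimpleGraph V} {u w x y : V} (h : LinkAdj Γ u w x y) :
    LinkAdj Γ u w y x :=
  h.imp (fun h => h.symm) fun h => Sym2.eq_swap.trans h

/-- A path, given by the list of its vertices, in `Γ` with the edge `uw` added, which uses the edge
`uw`. Closing such a path that covers all vertices to a cycle and deleting `uw` gives a Hamilton
path of `Γ` from `u` to `w`. -/
structure IsLinkPath (Γ : SimpleGraph V) (u w : V) (l : List V) : Prop where
  nodup : l.Nodup
  chain : l.IsChain (LinkAdj Γ u w)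
  link : Consecutive l u w

theorem isChain_linkAdj_reverse {Γ : SimpleGraph V} {u w : V} {l : List V} :
    l.reverse.IsChain (LinkAdj Γ u w) ↔ l.IsChain (LinkAdj Γ u w) := by
  rw [List.isChain_reverse]
  exact List.IsChain.iff fun a b => ⟨LinkAdj.symm, LinkAdj.symm⟩

theorem IsLinkPath.reverse {Γ : SimpleGraph V} {u w : V} {l : List V} (h : IsLinkPath Γ u w l) :
    IsLinkPath Γ u w l.reverse :=
  ⟨List.nodup_reverse.2 h.nodup, isChain_linkAdj_reverse.2 h.chain,
    consecutive_reverse.2 h.link⟩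

theorem IsLinkPath.two_le {Γ : SimpleGraph V} {u w : V} {l : List V} (h : IsLinkPath Γ u w l) :
    2 ≤ l.length := by
  rcases h.link with h | h <;> simpa using h.length_le

/-- Pósa rotation with fixed first vertex: the last vertex `r` of `p ++ v :: y :: s` is joined to
`v`, and the edge `vy`, which must not be the prescribed pair, is dropped. -/
def Rotation (Γ : SimpleGraph V) (u w : V) (l l' : List V) : Prop :=
  ∃ p v y s, l = p ++ v :: y :: s ∧ l' = p ++ v :: (y :: s).reverse ∧ s(v, y) ≠ s(u, w) ∧
    ∃ r ∈ (y :: s).getLast?, Γ.Adj r v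

theorem Rotation.perm {Γ : SimpleGraph V} {u w : V} {l l' : List V} (h : Rotation Γ u w l l') :
    l.Perm l' := by
  obtain ⟨p, v, y, s, rfl, rfl, -, -⟩ := h
  exact List.Perm.append_left _ (List.Perm.cons _ (List.reverse_perm _).symm)

theorem Rotation.head?_eq {Γ : SimpleGraph V} {u w : V} {l l' : List V}
    (h : Rotation Γ u w l l') : l'.head? = l.head? := by
  obtain ⟨p, v, y, s, rfl, rfl, -, -⟩ := h
  simp [List.head?_append]

/-- A rotation drops a single edge, and one end of that edge becomes the last vertex. -/
theorem Rotation.consecutive {Γ : SimpleGraph V} {u w : V} {l l' : List V}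
    (h : Rotation Γ u w l l') : ∃ v y, y ∈ l'.getLast? ∧ s(v, y) ≠ s(u, w) ∧
      ∀ a b, Consecutive l a b → Consecutive l' a b ∨ s(a, b) = s(v, y) := by
  obtain ⟨p, v, y, s, rfl, rfl, hne, -⟩ := h
  refine ⟨v, y, by simp [List.getLast?_append, List.getLast?_cons], hne, fun a b hab => ?_⟩
  rw [show p ++ v :: y :: s = (p ++ [v]) ++ (y :: s) by simp, consecutive_append] at hab
  rw [show p ++ v :: (y :: s).reverse = (p ++ [v]) ++ (y :: s).reverse by simp,
    consecutive_append, consecutive_reverse]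
  rcases hab with h | h | ⟨x, hx, z, hz, h⟩
  · exact Or.inl (Or.inl h)
  · exact Or.inl (Or.inr (Or.inl h))
  · simp at hx hz
    subst hx hz
    exact Or.inr h

theorem Rotation.isLinkPath {Γ : SimpleGraph V} {u w : V} {l l' : List V}
    (h : Rotation Γ u w l l') (hl : IsLinkPath Γ u w l) : IsLinkPath Γ u w l' := by
  obtain ⟨v, y, -, hne, hcons⟩ := h.consecutive
  refine ⟨h.perm.nodup_iff.1 hl.nodup, ?_, (hcons u w hl.link).resolve_right fun h => hne h.symm⟩
  obtain ⟨p, v, y, s, rfl, rfl, hne, r, hr, hadj⟩ := h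
  have hc := hl.chain
  rw [show p ++ v :: y :: s = (p ++ [v]) ++ (y :: s) by simp] at hc
  rw [show p ++ v :: (y :: s).reverse = (p ++ [v]) ++ (y :: s).reverse by simp]
  refine List.IsChain.append hc.left_of_append (isChain_linkAdj_reverse.2 hc.right_of_append) ?_
  intro x hx z hz
  rw [List.head?_reverse] at hz
  obtain rfl : r = z := Option.mem_unique hr hz
  simp at hx
  subst hx
  exact Or.inl hadj.symm

theorem reach_isLinkPath {Γ : SimpleGraph V} {u w : V} {l l' : List V}
    (h : Relation.ReflTransGen (Rotation Γ u w) l l') (hl : IsLinkPath Γ u w l) :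
    IsLinkPath Γ u w l' ∧ l.Perm l' ∧ l'.head? = l.head? := by
  induction h with
  | refl => exact ⟨hl, List.Perm.refl _, rfl⟩
  | tail _ h ih =>
    exact ⟨h.isLinkPath ih.1, ih.2.1.trans h.perm, h.head?_eq.trans ih.2.2⟩

/-- Cutting the closed path at the prescribed pair. -/
theorem isChain_cut {Γ Γ' : SimpleGraph V} {u w a b x y : V} {p s : List V}
    (hl : IsLinkPath Γ u w (p ++ x :: y :: s)) (hxy : s(x, y) = s(u, w)) (hle : Γ ≤ Γ')
    (hab : Γ'.Adj a b) (ha : a ∈ (p ++ x :: y :: s).head?) (hb : b ∈ (p ++ x :: y :: s).getLast?) :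
    ((y :: s) ++ (p ++ [x])).IsChain Γ'.Adj := by
  have hnd := hl.nodup
  have hc := hl.chain
  rw [show p ++ x :: y :: s = (p ++ [x]) ++ (y :: s) by simp] at hc hnd ha hb
  rw [List.nodup_append] at hnd
  have hx : x ∉ y :: s := fun h => hnd.2.2 x (by simp) x h rfl
  have hy : y ∉ p ++ [x] := fun h => hnd.2.2 y h y (by simp) rfl
  refine List.IsChain.append ?_ ?_ ?_
  · refine List.IsChain.imp_of_mem_imp (fun c d hc hd h => ?_) hc.right_of_append
    rcases h with h | h
    · exact hle h
    · rcases Sym2.eq_iff.1 (h.trans hxy.symm) with ⟨rfl, -⟩ | ⟨-, rfl⟩ <;> contradiction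
  · refine List.IsChain.imp_of_mem_imp (fun c d hc hd h => ?_) hc.left_of_append
    rcases h with h | h
    · exact hle h
    · rcases Sym2.eq_iff.1 (h.trans hxy.symm) with ⟨-, rfl⟩ | ⟨rfl, -⟩ <;> contradiction
  · intro c hc d hd
    have h1 : b = c := by
      rw [List.getLast?_append_of_ne_nil _ (by simp)] at hb
      exact Option.mem_unique hb hc
    have h2 : a = d := by
      rw [List.head?_append_of_ne_nil _ (by simp)] at ha
      exact Option.mem_unique ha hd
    rw [← h1, ← h2]
    exact hab.symm

/-- Opening the closed path at a vertex `v` that has a neighbour `z` outside. -/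
theorem isLinkPath_open {Γ Γ' : SimpleGraph V} {u w a b v z : V} {p s : List V}
    (hl : IsLinkPath Γ u w (p ++ v :: s)) (hle : Γ ≤ Γ') (hab : Γ'.Adj a b)
    (ha : a ∈ (p ++ v :: s).head?) (hb : b ∈ (p ++ v :: s).getLast?) (hz : z ∉ p ++ v :: s)
    (hzv : Γ'.Adj z v) (hlink : Consecutive p u w ∨ Consecutive (v :: s) u w) :
    IsLinkPath Γ' u w (z :: v :: s ++ p) := by
  have hnd := hl.nodup
  have hc := hl.chain
  have hc' : (p ++ v :: s).IsChain (LinkAdj Γ' u w) := hc.imp fun c d h => h.imp (fun h => hle h) id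
  refine ⟨?_, ?_, ?_⟩
  · rw [List.cons_append, List.nodup_cons]
    constructor
    · simp only [List.mem_append, not_or] at hz ⊢
      exact ⟨hz.2, hz.1⟩
    · exact (List.perm_append_comm.nodup_iff).1 hnd
  · refine List.IsChain.append ?_ hc'.left_of_append ?_
    · refine List.IsChain.cons_of_ne_nil (by simp) hc'.right_of_append ?_
      exact Or.inl (by simpa using hzv)
    · intro c hc d hd
      have h1 : b = c := by
        rw [List.getLast?_append_of_ne_nil _ (by simp)] at hb
        rw [List.getLast?_cons_cons] at hc
        exact Option.mem_unique hb hc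
      have h2 : a = d := by
        have hp : p ≠ [] := by rintro rfl; simp at hd
        rw [List.head?_append_of_ne_nil _ hp] at ha
        exact Option.mem_unique ha hd
      rw [← h1, ← h2]
      exact Or.inl hab.symm
  · rw [show z :: v :: s ++ p = [z] ++ ((v :: s) ++ p) by simp, consecutive_append,
      consecutive_append]
    tauto

theorem exists_isHamiltonian_of_list [DecidableEq V] {Γ : SimpleGraph V} {u w : V} {l : List V}
    (hnd : l.Nodup) (hmem : ∀ v, v ∈ l) (hchain : l.IsChain Γ.Adj) (hu : u ∈ l.head?)
    (hw : w ∈ l.getLast?) :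
    ∃ P : Γ.Walk u w, P.IsHamiltonian := by
  have hne : l ≠ [] := by rintro rfl; simp at hu
  have hu' : l.head hne = u := by
    rw [List.head?_eq_some_head hne] at hu
    exact Option.some_injective _ hu
  have hw' : l.getLast hne = w := by
    rw [List.getLast?_eq_some_getLast hne] at hw
    exact Option.some_injective _ hw
  subst hu' hw'
  refine ⟨Walk.ofSupport l hne hchain, Walk.IsPath.isHamiltonian_of_mem ?_ ?_⟩
  · rw [Walk.isPath_def, Walk.support_ofSupport]
    exact hnd
  · intro v
    rw [Walk.support_ofSupport]
    exact hmem v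

theorem exists_isHamiltonian_symm [DecidableEq V] {Γ : SimpleGraph V} {u w : V}
    (h : ∃ P : Γ.Walk u w, P.IsHamiltonian) : ∃ P : Γ.Walk w u, P.IsHamiltonian := by
  obtain ⟨P, hP⟩ := h
  refine ⟨P.reverse, fun v => ?_⟩
  rw [Walk.support_reverse, List.count_reverse]
  exact hP v

variable [Fintype V]

open Classical in
/-- The last vertices of the paths obtained from `l` by rotations with fixed first vertex. -/
noncomputable def rotationEnds (Γ : SimpleGraph V) (u w : V) (l : List V) : Finset V :=
  Finset.univ.filter fun r =>
    ∃ l', Relation.ReflTransGen (Rotation Γ u w) l l' ∧ r ∈ l'.getLast?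

open Classical in
/-- The vertices outside `S` with a neighbour in `S`. -/
noncomputable def outerNeighbors (Γ : SimpleGraph V) (S : Finset V) : Finset V :=
  Finset.univ.filter fun v => v ∉ S ∧ ∃ x ∈ S, Γ.Adj x v

theorem mem_rotationEnds {Γ : SimpleGraph V} {u w : V} {l : List V} {r : V} :
    r ∈ rotationEnds Γ u w l ↔
      ∃ l', Relation.ReflTransGen (Rotation Γ u w) l l' ∧ r ∈ l'.getLast? := by
  simp [rotationEnds]

theorem mem_outerNeighbors {Γ : SimpleGraph V} {S : Finset V} {v : V} :
    v ∈ outerNeighbors Γ S ↔ v ∉ S ∧ ∃ x ∈ S, Γ.Adj x v := by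
  simp [outerNeighbors]

/-- An edge of the initial path survives all rotations, unless one of its ends has been the last
vertex of a rotated path. -/
theorem reach_consecutive {Γ : SimpleGraph V} {u w : V} {l l' : List V}
    (h : Relation.ReflTransGen (Rotation Γ u w) l l') {a b : V} (hab : Consecutive l a b)
    (ha : a ∉ rotationEnds Γ u w l) (hb : b ∉ rotationEnds Γ u w l) : Consecutive l' a b := by
  induction h with
  | refl => exact hab
  | tail h₁ h₂ ih =>
    obtain ⟨v, y, hy, -, hcons⟩ := h₂.consecutive
    refine (hcons a b ih).resolve_right fun heq => ?_
    have hyR : y ∈ rotationEnds Γ u w l := mem_rotationEnds.2 ⟨_, h₁.tail h₂, hy⟩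
    rcases Sym2.eq_iff.1 heq with ⟨-, rfl⟩ | ⟨rfl, -⟩
    · exact hb hyR
    · exact ha hyR

/-- The core of Pósa's lemma: in a longest path, a neighbour of a rotation end which is not itself
a rotation end is next to a rotation end on the initial path, or is one of `u` and `w`. -/
theorem exists_rotationEnd_consecutive {Γ : SimpleGraph V} {u w : V} {l₀ : List V}
    (h₀ : IsLinkPath Γ u w l₀) (hmax : ∀ l, IsLinkPath Γ u w l → l.length ≤ l₀.length) {r v : V}
    (hr : r ∈ rotationEnds Γ u w l₀) (hadj : Γ.Adj r v) (hv : v ∉ rotationEnds Γ u w l₀) :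
    v = u ∨ v = w ∨ ∃ z ∈ rotationEnds Γ u w l₀, Consecutive l₀ v z := by
  obtain ⟨l, hreach, hlast⟩ := mem_rotationEnds.1 hr
  obtain ⟨hl, hperm, hhead⟩ := reach_isLinkPath hreach h₀
  have hvl : v ∈ l := by
    by_contra hvl
    have hlonger : IsLinkPath Γ u w (l ++ [v]) := by
      refine ⟨?_, ?_, consecutive_append.2 (Or.inl hl.link)⟩
      · rw [List.nodup_append]
        refine ⟨hl.nodup, by simp, ?_⟩
        rintro a ha b hb rfl
        exact hvl (by simpa using List.mem_singleton.1 hb ▸ ha)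
      · refine hl.chain.append (List.isChain_singleton v) ?_
        intro x hx z hz
        obtain rfl : r = x := Option.mem_unique hlast hx
        simp at hz
        subst hz
        exact Or.inl hadj
    have := hmax _ hlonger
    rw [hperm.length_eq] at this
    simp at this
  obtain ⟨p, s, hps⟩ := List.append_of_mem hvl
  obtain - | ⟨y, s⟩ := s
  · refine absurd (mem_rotationEnds.2 ⟨l, hreach, ?_⟩) hv
    simp [hps]
  by_cases huw : s(v, y) = s(u, w)
  · rcases Sym2.eq_iff.1 huw with ⟨rfl, -⟩ | ⟨rfl, -⟩ <;> simp
  have hyR : y ∈ rotationEnds Γ u w l₀ := by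
    refine mem_rotationEnds.2 ⟨p ++ v :: (y :: s).reverse, hreach.tail ⟨p, v, y, s, hps, rfl,
      huw, r, ?_, hadj⟩, ?_⟩
    · rw [hps] at hlast
      simpa [List.getLast?_append, List.getLast?_cons] using hlast
    · simp [List.getLast?_append, List.getLast?_cons]
  have hvy : [v, y] <:+: l := ⟨p, s, by simp [hps]⟩
  by_contra! hcon
  obtain ⟨-, -, hcon⟩ := hcon
  have hpersist : ∀ z, Consecutive l₀ v z → Consecutive l v z := fun z hz =>
    reach_consecutive hreach hz hv fun hzR => hcon z hzR hz
  obtain ⟨p₀, s₀, hps₀⟩ := List.append_of_mem (hperm.mem_iff.2 hvl)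
  obtain - | ⟨z₂, s₀⟩ := s₀
  · refine hv (mem_rotationEnds.2 ⟨l₀, Relation.ReflTransGen.refl, ?_⟩)
    simp [hps₀]
  have hz₂ : Consecutive l₀ v z₂ := Or.inl ⟨p₀, s₀, by simp [hps₀]⟩
  rcases hpersist z₂ hz₂ with h | h
  · exact hcon y hyR (succ_unique hl.nodup hvy h ▸ hz₂)
  rcases List.eq_nil_or_concat p₀ with rfl | ⟨p₁, z₁, rfl⟩
  · -- here `v` is the first vertex of both paths, so it has no predecessor on `l`
    rw [hps₀] at hhead
    obtain - | ⟨x, t⟩ := l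
    · simp at hhead
    · simp at hhead
      subst hhead
      obtain ⟨i, hi, hi'⟩ := pair_infix_iff.1 h
      have := (List.getElem?_inj (i := 0) (j := i + 1) (by simp) hl.nodup).1
        (by rw [hi', List.getElem?_cons_zero])
      omega
  · have hz₁ : Consecutive l₀ v z₁ := Or.inr ⟨p₁, z₂ :: s₀, by simp [hps₀]⟩
    rcases hpersist z₁ hz₁ with h' | h'
    · exact hcon y hyR (succ_unique hl.nodup hvy h' ▸ hz₁)
    · have hnd := h₀.nodup
      rw [hps₀, pred_unique hl.nodup h' h] at hnd
      simp [List.nodup_append] at hnd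

theorem card_filter_exists_le {R : Finset V} {P : V → V → Prop}
    [DecidablePred fun v => ∃ z ∈ R, P v z]
    (hP : ∀ z v v', P v z → P v' z → v = v') :
    (Finset.univ.filter fun v => ∃ z ∈ R, P v z).card ≤ R.card := by
  classical
  have h : ∀ v : V, ∃ z, (∃ z ∈ R, P v z) → z ∈ R ∧ P v z := by
    intro v
    by_cases h : ∃ z ∈ R, P v z
    · obtain ⟨z, hz⟩ := h
      exact ⟨z, fun _ => hz⟩
    · exact ⟨v, fun h' => absurd h' h⟩
  choose f hf using h
  refine Finset.card_le_card_of_injOn f ?_ ?_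
  · intro v hv
    exact (hf v (by simpa using hv)).1
  · intro v hv v' hv' heq
    have h1 := (hf v (by simpa using hv)).2
    have h2 := (hf v' (by simpa using hv')).2
    rw [← heq] at h2
    exact hP _ _ _ h1 h2

/-- Pósa's lemma for paths through the prescribed pair: only `u` and `w` add to the usual bound. -/
theorem card_outerNeighbors_rotationEnds_le {Γ : SimpleGraph V} {u w : V} {l₀ : List V}
    (h₀ : IsLinkPath Γ u w l₀) (hmax : ∀ l, IsLinkPath Γ u w l → l.length ≤ l₀.length) :
    (outerNeighbors Γ (rotationEnds Γ u w l₀)).card ≤ 2 * (rotationEnds Γ u w l₀).card + 2 := by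
  classical
  set R := rotationEnds Γ u w l₀ with hR
  have hsub : outerNeighbors Γ R ⊆ ((Finset.univ.filter fun v => ∃ z ∈ R, [v, z] <:+: l₀) ∪
      (Finset.univ.filter fun v => ∃ z ∈ R, [z, v] <:+: l₀)) ∪ {u, w} := by
    intro v hv
    obtain ⟨hvR, r, hr, hadj⟩ := mem_outerNeighbors.1 hv
    simp only [Finset.mem_union, Finset.mem_filter, Finset.mem_univ, true_and, Finset.mem_insert,
      Finset.mem_singleton]
    rcases exists_rotationEnd_consecutive h₀ hmax hr hadj hvR with h | h | ⟨z, hz, h | h⟩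
    · exact Or.inr (Or.inl h)
    · exact Or.inr (Or.inr h)
    · exact Or.inl (Or.inl ⟨z, hz, h⟩)
    · exact Or.inl (Or.inr ⟨z, hz, h⟩)
  have h1 : (Finset.univ.filter fun v => ∃ z ∈ R, [v, z] <:+: l₀).card ≤ R.card :=
    card_filter_exists_le fun z v v' h h' => pred_unique h₀.nodup h h'
  have h2 : (Finset.univ.filter fun v => ∃ z ∈ R, [z, v] <:+: l₀).card ≤ R.card :=
    card_filter_exists_le fun z v v' h h' => succ_unique h₀.nodup h h'
  have h3 : ({u, w} : Finset V).card ≤ 2 := Finset.card_le_two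
  have := Finset.card_le_card hsub
  have := Finset.card_union_le ((Finset.univ.filter fun v => ∃ z ∈ R, [v, z] <:+: l₀) ∪
      (Finset.univ.filter fun v => ∃ z ∈ R, [z, v] <:+: l₀)) {u, w}
  have := Finset.card_union_le (Finset.univ.filter fun v => ∃ z ∈ R, [v, z] <:+: l₀)
      (Finset.univ.filter fun v => ∃ z ∈ R, [z, v] <:+: l₀)
  omega

/-! ### Boosters of expanding graphs -/

/-- Every set of at most an eighth of the vertices expands by a factor larger than five. -/
def IsExpanding (Γ : SimpleGraph V) : Prop :=
  ∀ S : Finset V, S.Nonempty → 8 * S.card ≤ Fintype.card V →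
    5 * S.card + 3 ≤ (outerNeighbors Γ S).card

theorem IsExpanding.mono {Γ Γ' : SimpleGraph V} (hΓ : IsExpanding Γ) (h : Γ ≤ Γ') :
    IsExpanding Γ' := by
  intro S hS hS8
  refine (hΓ S hS hS8).trans (Finset.card_le_card fun v hv => ?_)
  obtain ⟨hvS, x, hx, hadj⟩ := mem_outerNeighbors.1 hv
  exact mem_outerNeighbors.2 ⟨hvS, x, hx, h hadj⟩

theorem IsExpanding.exists_adj_of_card_le {Γ : SimpleGraph V} (hΓ : IsExpanding Γ)
    (hV : 16 ≤ Fintype.card V) {O : Finset V} (hO : O.Nonempty)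
    (hO2 : 2 * O.card ≤ Fintype.card V) : ∃ x ∈ O, ∃ y ∉ O, Γ.Adj x y := by
  classical
  by_contra! hcon
  have key : ∀ S ⊆ O, S.Nonempty → 8 * S.card ≤ Fintype.card V → 6 * S.card + 3 ≤ O.card := by
    intro S hSO hS hS8
    have h1 := hΓ S hS hS8
    have h2 : S ∪ outerNeighbors Γ S ⊆ O := by
      refine Finset.union_subset hSO fun v hv => ?_
      obtain ⟨-, x, hx, hadj⟩ := mem_outerNeighbors.1 hv
      by_contra hvO
      exact hcon x (hSO hx) v hvO hadj
    have h3 := Finset.card_le_card h2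
    rw [Finset.card_union_of_disjoint] at h3
    · omega
    · exact Finset.disjoint_left.2 fun v hv hv' => (mem_outerNeighbors.1 hv').1 hv
  rcases le_total (8 * O.card) (Fintype.card V) with h8 | h8
  · have := key O subset_rfl hO h8
    omega
  · obtain ⟨S, hSO, hS⟩ := Finset.exists_subset_card_eq
      (show Fintype.card V / 8 ≤ O.card by omega)
    have := key S hSO (Finset.card_pos.1 (by omega)) (by omega)
    omega

/-- Expanding graphs are connected: a component of at most half of the vertices would contain the
outer neighbours of its subsets of size about `|V| / 8`. -/
theorem IsExpanding.exists_adj {Γ : SimpleGraph V} (hΓ : IsExpanding Γ)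
    (hV : 16 ≤ Fintype.card V) {O : Finset V} (hO : O.Nonempty) (hO' : O ≠ Finset.univ) :
    ∃ x ∈ O, ∃ y ∉ O, Γ.Adj x y := by
  classical
  rcases le_total (2 * O.card) (Fintype.card V) with h | h
  · exact hΓ.exists_adj_of_card_le hV hO h
  · have h1 := Finset.card_add_card_compl O
    obtain ⟨x, hx, y, hy, hadj⟩ := hΓ.exists_adj_of_card_le hV (O := Oᶜ)
      (Finset.nonempty_iff_ne_empty.2 fun h => hO' (by simpa using h)) (by omega)
    simp only [Finset.mem_compl, not_not] at hx hy
    exact ⟨y, hy, x, hx, hadj.symm⟩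

theorem IsExpanding.card_lt_rotationEnds {Γ : SimpleGraph V} (hΓ : IsExpanding Γ) {u w : V}
    {l₀ : List V} (h₀ : IsLinkPath Γ u w l₀)
    (hmax : ∀ l, IsLinkPath Γ u w l → l.length ≤ l₀.length) :
    Fintype.card V < 8 * (rotationEnds Γ u w l₀).card := by
  by_contra! hle
  have hne : (rotationEnds Γ u w l₀).Nonempty := by
    have h2 := h₀.two_le
    have hnil : l₀ ≠ [] := by rintro rfl; simp at h2
    exact ⟨l₀.getLast hnil, mem_rotationEnds.2 ⟨l₀, Relation.ReflTransGen.refl,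
      List.getLast?_eq_some_getLast hnil⟩⟩
  have h1 := hΓ _ hne hle
  have h2 := card_outerNeighbors_rotationEnds_le h₀ hmax
  omega

theorem exists_longest_isLinkPath (Γ : SimpleGraph V) {u w : V} (huw : u ≠ w) :
    ∃ l₀, IsLinkPath Γ u w l₀ ∧ ∀ l, IsLinkPath Γ u w l → l.length ≤ l₀.length := by
  have hex : ∃ n l, IsLinkPath Γ u w l ∧ l.length = n :=
    ⟨_, [u, w], ⟨by simp [huw], by simp [LinkAdj], Or.inl List.infix_rfl⟩, rfl⟩
  classical
  have hbdd : ∀ n, (∃ l, IsLinkPath Γ u w l ∧ l.length = n) → n ≤ Fintype.card V := by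
    rintro n ⟨l, hl, rfl⟩
    exact hl.nodup.length_le_card
  obtain ⟨n, hn⟩ := hex
  obtain ⟨l₀, hl₀, hlen⟩ := Nat.findGreatest_spec
    (P := fun n => ∃ l, IsLinkPath Γ u w l ∧ l.length = n) (hbdd n hn) hn
  refine ⟨l₀, hl₀, fun l hl => ?_⟩
  rw [hlen]
  exact Nat.le_findGreatest (hbdd _ ⟨l, hl, rfl⟩) ⟨l, hl, rfl⟩

variable [DecidableEq V]

/-- Joining the ends `a`, `b` of a path through the prescribed pair gives a cycle. Either it is a
Hamilton cycle, or an edge leaving the cycle makes a longer path. -/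
theorem isHamiltonian_or_longer {Γ Γ' : SimpleGraph V} {u w a b : V} {l : List V}
    (hconn : ∀ O : Finset V, O.Nonempty → O ≠ Finset.univ → ∃ x ∈ O, ∃ y ∉ O, Γ.Adj x y)
    (hl : IsLinkPath Γ u w l) (hle : Γ ≤ Γ') (hab : Γ'.Adj a b) (ha : a ∈ l.head?)
    (hb : b ∈ l.getLast?) :
    (∃ P : Γ'.Walk u w, P.IsHamiltonian) ∨ ∃ l', IsLinkPath Γ' u w l' ∧ l.length < l'.length := by
  by_cases hall : ∀ v, v ∈ l
  · left
    have key : ∀ x y p s, l = p ++ x :: y :: s → s(x, y) = s(u, w) →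
        ∃ P : Γ'.Walk y x, P.IsHamiltonian := by
      rintro x y p s rfl hxy
      refine exists_isHamiltonian_of_list (l := (y :: s) ++ (p ++ [x])) ?_ ?_
        (isChain_cut hl hxy hle hab ha hb) (by simp) (by simp [List.getLast?_cons])
      · refine (List.perm_append_comm.nodup_iff).1 ?_
        simpa using hl.nodup
      · intro v
        have := hall v
        simp only [List.mem_append, List.mem_cons, List.not_mem_nil, or_false] at this ⊢
        tauto
    rcases hl.link with ⟨p, s, h⟩ | ⟨p, s, h⟩
    · exact exists_isHamiltonian_symm (key u w p s (by simp [← h]) rfl)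
    · exact key w u p s (by simp [← h]) Sym2.eq_swap
  · right
    have hnil : l ≠ [] := by rintro rfl; simp at ha
    obtain ⟨v, hv, z, hz, hadj⟩ := hconn l.toFinset
      ⟨l.head hnil, by simp⟩ (fun h => hall fun v => by
        rw [← List.mem_toFinset, h]; exact Finset.mem_univ v)
    rw [List.mem_toFinset] at hv hz
    obtain ⟨p, s, rfl⟩ := List.append_of_mem hv
    have hlink := hl.link
    rw [consecutive_append] at hlink
    by_cases hdir : Consecutive p u w ∨ Consecutive (v :: s) u w
    · refine ⟨_, isLinkPath_open hl hle hab ha hb hz (hle hadj.symm) hdir, ?_⟩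
      simp
      omega
    · -- the prescribed pair ends in `v`, so the cycle is opened in the other direction
      have hlink' : ∃ x ∈ p.getLast?, s(u, w) = s(x, v) := by
        rcases hlink with h | h | ⟨x, hx, y, hy, h⟩
        · exact absurd (Or.inl h) hdir
        · exact absurd (Or.inr h) hdir
        · simp at hy
          exact ⟨x, hx, hy ▸ h⟩
      obtain ⟨x, hx, hxv⟩ := hlink'
      have hrev : (p ++ v :: s).reverse = s.reverse ++ v :: p.reverse := by simp
      have hl' := hl.reverse
      rw [hrev] at hl'
      refine ⟨_, isLinkPath_open (z := z) hl' hle hab.symm ?_ ?_ ?_ (hle hadj.symm) (Or.inr ?_), ?_⟩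
      · rw [← hrev, List.head?_reverse]; exact hb
      · rw [← hrev, List.getLast?_reverse]; exact ha
      · rw [← hrev, List.mem_reverse]; exact hz
      · rw [show v :: p.reverse = (p ++ [v]).reverse by simp, consecutive_reverse,
          consecutive_append]
        exact Or.inr (Or.inr ⟨x, hx, v, by simp, hxv⟩)
      · simp
        omega

/-- Adding a booster to `Γ` creates a Hamilton path from `u` to `w`, or a path through the
prescribed pair that is longer than all those of `Γ`. -/
def IsBooster (Γ : SimpleGraph V) (u w : V) (e : Sym2 V) : Prop :=
  ¬ e.IsDiag ∧ ∀ Γ' : SimpleGraph V, Γ ≤ Γ' → e ∈ Γ'.edgeSet →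
    (∃ P : Γ'.Walk u w, P.IsHamiltonian) ∨
      ∃ l', IsLinkPath Γ' u w l' ∧ ∀ l, IsLinkPath Γ u w l → l.length < l'.length

open Classical in
/-- An expanding graph has quadratically many boosters: rotate a longest path first at one end and
then, for each of the ends obtained, at the other end. -/
theorem IsExpanding.card_boosters {Γ : SimpleGraph V} (hΓ : IsExpanding Γ)
    (hV : 16 ≤ Fintype.card V) {u w : V} (huw : u ≠ w) :
    Fintype.card V ^ 2 ≤ 128 * (Finset.univ.filter fun e => IsBooster Γ u w e).card := by
  obtain ⟨l₀, h₀, hmax⟩ := exists_longest_isLinkPath Γ huw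
  have hR := hΓ.card_lt_rotationEnds h₀ hmax
  set R := rotationEnds Γ u w l₀
  have hex : ∀ r, ∃ l, r ∈ R → IsLinkPath Γ u w l ∧ l.length = l₀.length ∧ r ∈ l.head? := by
    intro r
    by_cases hr : r ∈ R
    · obtain ⟨l, hl, hr'⟩ := mem_rotationEnds.1 hr
      obtain ⟨h1, h2, -⟩ := reach_isLinkPath hl h₀
      exact ⟨l.reverse, fun _ => ⟨h1.reverse, by simpa using h2.length_eq.symm, by simpa using hr'⟩⟩
    · exact ⟨[], fun h => absurd h hr⟩
  choose L hL using hex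
  set T := R.sigma fun r => rotationEnds Γ u w (L r) with hT
  have hTcard : Fintype.card V ^ 2 ≤ 64 * T.card := by
    have h1 : ∑ _r ∈ R, Fintype.card V ≤ ∑ r ∈ R, 8 * (rotationEnds Γ u w (L r)).card := by
      refine Finset.sum_le_sum fun r hr => ?_
      obtain ⟨h1, h2, -⟩ := hL r hr
      exact (hΓ.card_lt_rotationEnds h1 (by rwa [h2])).le
    rw [← Finset.mul_sum, ← Finset.card_sigma, ← hT, Finset.sum_const, smul_eq_mul] at h1
    calc Fintype.card V ^ 2 = Fintype.card V * Fintype.card V := sq _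
      _ ≤ 8 * R.card * Fintype.card V := Nat.mul_le_mul_right _ hR.le
      _ = 8 * (R.card * Fintype.card V) := by ring
      _ ≤ 8 * (8 * T.card) := Nat.mul_le_mul_left _ h1
      _ = 64 * T.card := by ring
  have himage : T.image (fun x => s(x.1, x.2)) ⊆ Finset.univ.filter fun e => IsBooster Γ u w e := by
    intro e he
    obtain ⟨⟨r, t⟩, hrt, rfl⟩ := Finset.mem_image.1 he
    obtain ⟨hr, ht⟩ := Finset.mem_sigma.1 hrt
    obtain ⟨h1, h2, h3⟩ := hL r hr
    obtain ⟨l, hl, htl⟩ := mem_rotationEnds.1 ht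
    obtain ⟨h4, h5, h6⟩ := reach_isLinkPath hl h1
    refine Finset.mem_filter.2 ⟨Finset.mem_univ _, ?_, fun Γ' hle hadj => ?_⟩
    · intro hdiag
      have hrt' : r = t := by simpa using hdiag
      subst hrt'
      have h7 := h4.two_le
      have h8 := h4.nodup
      rw [← h6] at h3
      obtain - | ⟨x, - | ⟨y, l⟩⟩ := l
      · simp at h7
      · simp at h7
      · simp at h3
        subst h3
        rw [List.getLast?_cons_cons] at htl
        exact (List.nodup_cons.1 h8).1 (List.mem_of_getLast? htl)
    · rcases isHamiltonian_or_longer (fun O hO hO' => hΓ.exists_adj hV hO hO') h4 hle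
        (show Γ'.Adj r t from hadj) (h6 ▸ h3) htl with h | ⟨l', hl', hlen⟩
      · exact Or.inl h
      · refine Or.inr ⟨l', hl', fun l'' hl'' => (hmax l'' hl'').trans_lt ?_⟩
        rwa [← h2, h5.length_eq]
  have hfib : T.card ≤ 2 * (T.image fun x => s(x.1, x.2)).card := by
    refine Finset.card_le_mul_card_image T 2 fun e _ => ?_
    induction e with
    | _ x y =>
    refine (Finset.card_le_card (t := {⟨x, y⟩, ⟨y, x⟩}) ?_).trans Finset.card_le_two
    rintro ⟨r, t⟩ h
    have h' := (Finset.mem_filter.1 h).2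
    rcases Sym2.eq_iff.1 h' with ⟨rfl, rfl⟩ | ⟨rfl, rfl⟩ <;> simp
  have := Finset.card_le_card himage
  omega

/-- If each graph that arises from `Γ₀` by adding at most `|V|` edges of `M ≥ Γ₀` has a booster in
`M`, then adding boosters one after another leads to a Hamilton path from `u` to `w`. -/
theorem exists_isHamiltonian_of_boosters {Γ₀ M : SimpleGraph V} (hle : Γ₀ ≤ M) {u w : V}
    (huw : u ≠ w)
    (hboost : ∀ Y : Finset (Sym2 V), Y.card ≤ Fintype.card V →
      ∃ e ∈ M.edgeSet, IsBooster (Γ₀ ⊔ fromEdgeSet (Y : Set (Sym2 V))) u w e) :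
    ∃ P : M.Walk u w, P.IsHamiltonian := by
  by_contra hnot
  have key : ∀ j ≤ Fintype.card V + 1, ∃ Y : Finset (Sym2 V), Y.card ≤ j ∧
      (Y : Set (Sym2 V)) ⊆ M.edgeSet ∧
      ∃ l, IsLinkPath (Γ₀ ⊔ fromEdgeSet (Y : Set (Sym2 V))) u w l ∧ j ≤ l.length := by
    intro j
    induction j with
    | zero =>
      intro _
      exact ⟨∅, by simp, by simp, [u, w],
        ⟨by simp [huw], by simp [LinkAdj], Or.inl List.infix_rfl⟩, by simp⟩
    | succ j ih =>
      intro hj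
      obtain ⟨Y, hYj, hYM, l, hl, hlj⟩ := ih (by omega)
      obtain ⟨e, heM, hdiag, he⟩ := hboost Y (by omega)
      set Γ' := Γ₀ ⊔ fromEdgeSet ((insert e Y : Finset (Sym2 V)) : Set (Sym2 V)) with hΓ'
      have hsub : ((insert e Y : Finset (Sym2 V)) : Set (Sym2 V)) ⊆ M.edgeSet := by
        rw [Finset.coe_insert]
        exact Set.insert_subset heM hYM
      have hΓ'M : Γ' ≤ M := by
        refine sup_le hle ?_
        calc fromEdgeSet ((insert e Y : Finset (Sym2 V)) : Set (Sym2 V))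
            ≤ fromEdgeSet M.edgeSet := fromEdgeSet_mono hsub
          _ = M := fromEdgeSet_edgeSet M
      rcases he Γ' (sup_le_sup_left (fromEdgeSet_mono (by simp)) _) (by
        rw [hΓ', edgeSet_sup, edgeSet_fromEdgeSet]
        exact Or.inr ⟨by simp, hdiag⟩) with ⟨P, hP⟩ | ⟨l', hl', hlonger⟩
      · exact absurd ⟨P.mapLe hΓ'M, fun v => by simpa using hP v⟩ hnot
      · refine ⟨insert e Y, (Finset.card_insert_le _ _).trans (by omega), hsub, l', hl', ?_⟩
        have := hlonger l hl
        omega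
  obtain ⟨Y, -, -, l, hl, hlen⟩ := key _ le_rfl
  have := hl.nodup.length_le_card
  omega

end SimpleGraph

/-! ### The two families of sets that Maker has to hit -/

namespace SimpleGraph

open MakerBreaker

variable {V : Type*} [Fintype V] [DecidableEq V]

open Classical in
/-- The edges of `G` that join `S` to the complement of `U`. -/
noncomputable def crossingEdges (G : SimpleGraph V) [DecidableRel G.Adj] (S U : Finset V) :
    Finset (Sym2 V) :=
  G.edgeFinset.filter fun e => ∃ x ∈ S, ∃ y ∉ U, e = s(x, y)

theorem card_crossingEdges_ge (G : SimpleGraph V) [DecidableRel G.Adj] {S U : Finset V}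
    (hSU : S ⊆ U) : S.card * (G.minDegree - U.card) ≤ (crossingEdges G S U).card := by
  classical
  set T := S.sigma fun x => G.neighborFinset x \ U with hT
  have h1 : S.card * (G.minDegree - U.card) ≤ T.card := by
    rw [hT, Finset.card_sigma, ← smul_eq_mul]
    refine Finset.card_nsmul_le_sum _ _ _ fun x _ => ?_
    have h2 := Finset.le_card_sdiff U (G.neighborFinset x)
    have h3 := G.minDegree_le_degree x
    rw [G.card_neighborFinset_eq_degree] at h2
    omega
  refine h1.trans (Finset.card_le_card_of_injOn (fun p => s(p.1, p.2)) ?_ ?_)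
  · rintro ⟨x, y⟩ hxy
    simp only [hT, Finset.coe_sigma, Set.mem_sigma_iff, Finset.mem_coe, Finset.mem_sdiff,
      mem_neighborFinset] at hxy
    simp only [crossingEdges, Finset.coe_filter, Set.mem_ofPred_eq, mem_edgeFinset, mem_edgeSet]
    exact ⟨hxy.2.1, x, hxy.1, y, hxy.2.2, rfl⟩
  · rintro ⟨x, y⟩ hxy ⟨x', y'⟩ hxy' heq
    simp only [hT, Finset.coe_sigma, Set.mem_sigma_iff, Finset.mem_coe, Finset.mem_sdiff]
      at hxy hxy'
    rcases Sym2.eq_iff.1 heq with ⟨rfl, rfl⟩ | ⟨rfl, rfl⟩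
    · rfl
    · exact absurd (hSU hxy'.1) hxy.2.2

variable (V) in
/-- The pairs `(S, U)` for which hitting all edges from `S` to the complement of `U` makes a graph
expanding. -/
def expansionPairs : Finset (Finset V × Finset V) :=
  Finset.univ.filter fun p => p.1.Nonempty ∧ 8 * p.1.card ≤ Fintype.card V ∧ p.1 ⊆ p.2 ∧
    p.2.card = 6 * p.1.card + 2

/-- If `S` had too few outer neighbours, then these would fit, together with `S`, into a set `U`
such that no claimed edge joins `S` to the complement of `U`. -/
theorem isExpanding_of_hits {G : SimpleGraph V} [DecidableRel G.Adj] {M : Finset (Sym2 V)}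
    (hM : ∀ p ∈ expansionPairs V, ¬ Disjoint (crossingEdges G p.1 p.2) M) :
    IsExpanding (fromEdgeSet (M : Set (Sym2 V))) := by
  intro S hS hS8
  by_contra! hlt
  set N := outerNeighbors (fromEdgeSet (M : Set (Sym2 V))) S with hN
  have h1 := Finset.card_union_le S N
  have hpos := hS.card_pos
  obtain ⟨U, hU, -, hUcard⟩ := Finset.exists_subsuperset_card_eq (Finset.subset_univ (S ∪ N))
    (show (S ∪ N).card ≤ 6 * S.card + 2 by omega) (by rw [Finset.card_univ]; omega)
  have hSU : S ⊆ U := Finset.subset_union_left.trans hU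
  have h2 := hM (S, U) (by simp [expansionPairs, hS, hS8, hSU, hUcard])
  obtain ⟨e, he, heM⟩ := Finset.not_disjoint_iff.1 h2
  obtain ⟨-, x, hx, y, hy, rfl⟩ := Finset.mem_filter.1 he
  refine hy (hU (Finset.mem_union_right _ (mem_outerNeighbors.2 ⟨fun h => hy (hSU h), x, hx, ?_⟩)))
  rw [fromEdgeSet_adj]
  exact ⟨heM, fun h => hy (hSU (h ▸ hx))⟩

/-- The Erdős–Selfridge sum of the first stage. -/
theorem sum_crossingEdges_lt {G : SimpleGraph V} [DecidableRel G.Adj] {Q : ℕ} (hQ : 0 < Q)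
    (hk : 64 ≤ Fintype.card V)
    (hdeg : (Fintype.card V : ℝ) - Fintype.card V / 1024 ≤ G.minDegree)
    (hz : (2 : ℝ) ^ (-((Fintype.card V : ℝ) / 256 / Q)) ≤ ((Fintype.card V : ℝ) ^ 10)⁻¹) :
    ∑ p ∈ expansionPairs V, (2 : ℝ) ^ (-(((crossingEdges G p.1 p.2).card : ℝ) / Q)) < 1 / 2 := by
  set k := Fintype.card V with hkdef
  set z : ℝ := (2 : ℝ) ^ (-((k : ℝ) / 256 / Q)) with hzdef
  have hQ' : (0 : ℝ) < Q := by exact_mod_cast hQ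
  have hk' : (64 : ℝ) ≤ k := by exact_mod_cast hk
  have hz0 : 0 < z := by positivity
  have hterm : ∀ p ∈ expansionPairs V,
      (2 : ℝ) ^ (-(((crossingEdges G p.1 p.2).card : ℝ) / Q)) ≤ z ^ p.1.card := by
    rintro ⟨S, U⟩ hp
    simp only [expansionPairs, Finset.mem_filter, Finset.mem_univ, true_and] at hp
    obtain ⟨hS, hS8, hSU, hU⟩ := hp
    have h1 := card_crossingEdges_ge G hSU
    have h2 : (S.card : ℝ) * (G.minDegree - U.card) ≤ (crossingEdges G S U).card := by
      refine le_trans ?_ (Nat.cast_le.2 h1)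
      push_cast
      exact mul_le_mul_of_nonneg_left (by rw [sub_le_iff_le_add]; norm_cast; omega) (by positivity)
    have h3 : (U.card : ℝ) = 6 * S.card + 2 := by exact_mod_cast hU
    have h4 : 8 * (S.card : ℝ) ≤ k := by exact_mod_cast hS8
    have h5 : (S.card : ℝ) * (k / 256) ≤ (crossingEdges G S U).card := by
      refine le_trans (mul_le_mul_of_nonneg_left ?_ (by positivity)) h2
      linarith
    rw [hzdef, ← Real.rpow_mul_natCast (by norm_num)]
    refine Real.rpow_le_rpow_of_exponent_le (by norm_num) ?_
    have h6 : (S.card : ℝ) * (k / 256) / Q ≤ (crossingEdges G S U).card / Q := by gcongr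
    calc -(((crossingEdges G S U).card : ℝ) / Q) ≤ -((S.card : ℝ) * (k / 256) / Q) :=
          neg_le_neg h6
      _ = _ := by ring
  have hcount : ∀ n,
      ((Finset.univ.filter fun U : Finset V => U.card = n).card : ℝ) ≤ (k : ℝ) ^ n := by
    intro n
    have h1 : (Finset.univ.filter fun U : Finset V => U.card = n) =
        Finset.powersetCard n Finset.univ := by
      ext U; simp [Finset.mem_powersetCard]
    rw [h1, Finset.card_powersetCard, Finset.card_univ]
    exact_mod_cast Nat.choose_le_pow k n
  set T : Finset (Finset V × Finset V) :=
    ((Finset.univ.erase (∅ : Finset V)).sigma (fun S =>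
      Finset.univ.filter fun U : Finset V => U.card = 6 * S.card + 2)).map
        (Equiv.sigmaEquivProd _ _).toEmbedding with hT
  have hsub : expansionPairs V ⊆ T := by
    rintro ⟨S, U⟩ hp
    simp only [expansionPairs, Finset.mem_filter, Finset.mem_univ, true_and] at hp
    simp [hT, hp.1.ne_empty, hp.2.2.2]
  have hkz : (k : ℝ) ^ 8 * z ≤ ((k : ℝ) ^ 2)⁻¹ := by
    calc (k : ℝ) ^ 8 * z ≤ (k : ℝ) ^ 8 * ((k : ℝ) ^ 10)⁻¹ := by gcongr
      _ = ((k : ℝ) ^ 2)⁻¹ := by field_simp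
  have hexp : (1 + ((k : ℝ) ^ 2)⁻¹) ^ k < 3 / 2 := by
    have h1 : (1 + ((k : ℝ) ^ 2)⁻¹) ^ k ≤ Real.exp ((k : ℝ)⁻¹) := by
      calc (1 + ((k : ℝ) ^ 2)⁻¹) ^ k ≤ (Real.exp (((k : ℝ) ^ 2)⁻¹)) ^ k := by
            gcongr
            rw [add_comm]
            exact Real.add_one_le_exp _
        _ = Real.exp ((k : ℝ)⁻¹) := by
            rw [← Real.exp_nat_mul]
            congr 1
            field_simp
    have h2 : (k : ℝ)⁻¹ ≤ 1 / 64 := by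
      rw [inv_eq_one_div]
      exact one_div_le_one_div_of_le (by norm_num) hk'
    have h3 : Real.exp ((k : ℝ)⁻¹) ≤ 1 / (1 - (k : ℝ)⁻¹) :=
      Real.exp_bound_div_one_sub_of_interval (by positivity) (by linarith)
    refine h1.trans_lt (h3.trans_lt ?_)
    rw [div_lt_div_iff₀ (by linarith) (by norm_num)]
    linarith
  calc ∑ p ∈ expansionPairs V, (2 : ℝ) ^ (-(((crossingEdges G p.1 p.2).card : ℝ) / Q))
      ≤ ∑ p ∈ expansionPairs V, z ^ p.1.card := Finset.sum_le_sum hterm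
    _ ≤ ∑ p ∈ T, z ^ p.1.card :=
        Finset.sum_le_sum_of_subset_of_nonneg hsub fun _ _ _ => by positivity
    _ = ∑ S ∈ Finset.univ.erase (∅ : Finset V),
          ((Finset.univ.filter fun U : Finset V => U.card = 6 * S.card + 2).card : ℝ) *
            z ^ S.card := by
        rw [hT, Finset.sum_map, Finset.sum_sigma]
        refine Finset.sum_congr rfl fun S _ => ?_
        simp
    _ ≤ ∑ S ∈ Finset.univ.erase (∅ : Finset V), (((k : ℝ) ^ 2)⁻¹) ^ S.card := by
        refine Finset.sum_le_sum fun S hS => ?_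
        have hpos : 1 ≤ S.card :=
          Finset.card_pos.2 (Finset.nonempty_iff_ne_empty.2 (Finset.ne_of_mem_erase hS))
        calc ((Finset.univ.filter fun U : Finset V => U.card = 6 * S.card + 2).card : ℝ) *
              z ^ S.card ≤ (k : ℝ) ^ (6 * S.card + 2) * z ^ S.card := by
              gcongr
              exact hcount _
          _ ≤ (k : ℝ) ^ (8 * S.card) * z ^ S.card := by
              gcongr
              · linarith
              · omega
          _ = ((k : ℝ) ^ 8 * z) ^ S.card := by rw [mul_pow, pow_mul]
          _ ≤ (((k : ℝ) ^ 2)⁻¹) ^ S.card := by gcongr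
    _ = (1 + ((k : ℝ) ^ 2)⁻¹) ^ k - 1 := by
        rw [Finset.sum_erase_eq_sub (Finset.mem_univ _), Finset.card_empty, pow_zero, add_comm]
        congr 1
        have := Finset.sum_pow_mul_eq_add_pow (((k : ℝ) ^ 2)⁻¹) 1 (Finset.univ : Finset V)
        simpa using this
    _ < 1 / 2 := by linarith

/-- There are at most `(|β| + 1) ^ n` subsets of `β` with at most `n` elements. -/
theorem card_filter_card_le {β : Type*} [Fintype β] [DecidableEq β] (n : ℕ) :
    (Finset.univ.filter fun Y : Finset β => Y.card ≤ n).card ≤ (Fintype.card β + 1) ^ n := by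
  induction n with
  | zero => simp [Finset.card_eq_zero, Finset.filter_eq']
  | succ n ih =>
    have hsub : (Finset.univ.filter fun Y : Finset β => Y.card ≤ n + 1) ⊆
        ((Finset.univ : Finset (Option β)) ×ˢ
          Finset.univ.filter fun Y : Finset β => Y.card ≤ n).image
          (fun p => p.2 ∪ p.1.toFinset) := by
      intro Y hY
      have hY' : Y.card ≤ n + 1 := by simpa using hY
      rw [Finset.mem_image]
      rcases Y.eq_empty_or_nonempty with rfl | ⟨y, hy⟩
      · exact ⟨(none, ∅), by simp, by simp⟩
      · refine ⟨(some y, Y.erase y), ?_, ?_⟩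
        · have := Finset.card_erase_of_mem hy
          simp
          omega
        · ext a
          by_cases ha : a = y <;> simp [ha, hy]
    calc _ ≤ _ := Finset.card_le_card hsub
      _ ≤ _ := Finset.card_image_le
      _ = (Fintype.card β + 1) * _ := by
        rw [Finset.card_product, Finset.card_univ, Fintype.card_option]
      _ ≤ (Fintype.card β + 1) * (Fintype.card β + 1) ^ n := Nat.mul_le_mul_left _ ih
      _ = _ := by ring

open Classical in
/-- The boosters of `Γ₀ ∪ Y` for the pair `u, w` that are edges of `G` not claimed by Breaker, where
`i = (Y, u, w)`. -/
noncomputable def freeBoosters (G : SimpleGraph V) [DecidableRel G.Adj] (Γ₀ : SimpleGraph V)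
    (B : Finset (Sym2 V)) (i : Finset (Sym2 V) × V × V) : Finset (Sym2 V) :=
  (G.edgeFinset \ B).filter fun e =>
    IsBooster (Γ₀ ⊔ fromEdgeSet (i.1 : Set (Sym2 V))) i.2.1 i.2.2 e

variable (V) in
/-- The triples `(Y, u, w)` of a set `Y` of at most `|V|` additional edges and a pair of distinct
vertices. -/
def boosterIndices : Finset (Finset (Sym2 V) × V × V) :=
  (Finset.univ.filter fun Y : Finset (Sym2 V) => Y.card ≤ Fintype.card V) ×ˢ
    Finset.univ.filter fun p : V × V => p.1 ≠ p.2

theorem card_compl_edgeFinset_le (G : SimpleGraph V) [DecidableRel G.Adj] {γ : ℝ}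
    (hdeg : (Fintype.card V : ℝ) - γ ≤ G.minDegree) (hγ : 0 ≤ γ) :
    (Gᶜ.edgeFinset.card : ℝ) ≤ Fintype.card V * γ := by
  have h1 := Gᶜ.sum_degrees_eq_twice_card_edges
  have h2 : ∀ v, (Gᶜ.degree v : ℝ) ≤ γ := by
    intro v
    have h3 := G.degree_compl v
    have h4 := G.minDegree_le_degree v
    rcases Nat.eq_zero_or_pos (Gᶜ.degree v) with h | h
    · rw [h]; exact_mod_cast hγ
    · have h5 : Gᶜ.degree v + G.minDegree ≤ Fintype.card V := by omega
      have h6 : (Gᶜ.degree v : ℝ) + G.minDegree ≤ Fintype.card V := by exact_mod_cast h5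
      linarith
  have h3 : ((∑ v, Gᶜ.degree v : ℕ) : ℝ) ≤ Fintype.card V * γ := by
    push_cast
    calc ∑ v, (Gᶜ.degree v : ℝ) ≤ ∑ _v : V, γ := Finset.sum_le_sum fun v _ => h2 v
      _ = Fintype.card V * γ := by simp
  rw [h1] at h3
  push_cast at h3
  have : (0 : ℝ) ≤ Gᶜ.edgeFinset.card := by positivity
  linarith

theorem card_freeBoosters_ge {G : SimpleGraph V} [DecidableRel G.Adj] {Γ₀ : SimpleGraph V}
    (hΓ₀ : IsExpanding Γ₀) (hk : 64 ≤ Fintype.card V)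
    (hdeg : (Fintype.card V : ℝ) - Fintype.card V / 1024 ≤ G.minDegree) {B : Finset (Sym2 V)}
    (hB : 512 * B.card ≤ Fintype.card V ^ 2) {i : Finset (Sym2 V) × V × V}
    (hi : i.2.1 ≠ i.2.2) :
    (Fintype.card V : ℝ) ^ 2 / 256 ≤ (freeBoosters G Γ₀ B i).card := by
  classical
  have h1 := (hΓ₀.mono (le_sup_left (b := fromEdgeSet (i.1 : Set (Sym2 V))))).card_boosters
    (by omega) hi
  have h2 : (Finset.univ.filter fun e =>
      IsBooster (Γ₀ ⊔ fromEdgeSet (i.1 : Set (Sym2 V))) i.2.1 i.2.2 e) ⊆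
      (freeBoosters G Γ₀ B i ∪ Gᶜ.edgeFinset) ∪ B := by
    intro e he
    have he' := (Finset.mem_filter.1 he).2
    simp only [Finset.mem_union, freeBoosters, Finset.mem_filter, Finset.mem_sdiff]
    by_cases heB : e ∈ B
    · exact Or.inr heB
    · by_cases heG : e ∈ G.edgeFinset
      · exact Or.inl (Or.inl ⟨⟨heG, heB⟩, he'⟩)
      · refine Or.inl (Or.inr ?_)
        have hd := he'.1
        revert heG hd
        induction e with
        | _ x y =>
        simp only [mem_edgeFinset, mem_edgeSet, compl_adj, Sym2.mk_isDiag_iff]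
        tauto
  have h3 := Finset.card_le_card h2
  have h4 := Finset.card_union_le (freeBoosters G Γ₀ B i ∪ Gᶜ.edgeFinset) B
  have h5 := Finset.card_union_le (freeBoosters G Γ₀ B i) Gᶜ.edgeFinset
  have h6 := card_compl_edgeFinset_le G hdeg (by positivity)
  have h7 : (Fintype.card V : ℝ) ^ 2 ≤
      128 * ((freeBoosters G Γ₀ B i).card + Gᶜ.edgeFinset.card + B.card) := by
    exact_mod_cast h1.trans (Nat.mul_le_mul_left _ (by omega))
  have h8 : 512 * (B.card : ℝ) ≤ (Fintype.card V : ℝ) ^ 2 := by exact_mod_cast hB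
  have h9 : (Fintype.card V : ℝ) * (Fintype.card V / 1024) = (Fintype.card V : ℝ) ^ 2 / 1024 := by
    ring
  have h10 : (0 : ℝ) ≤ (Fintype.card V : ℝ) ^ 2 := by positivity
  linarith

/-- The Erdős–Selfridge sum of the second stage. -/
theorem sum_freeBoosters_lt {G : SimpleGraph V} [DecidableRel G.Adj] {Γ₀ : SimpleGraph V}
    (hΓ₀ : IsExpanding Γ₀) {Q : ℕ} (hQ : 0 < Q) (hk : 64 ≤ Fintype.card V)
    (hdeg : (Fintype.card V : ℝ) - Fintype.card V / 1024 ≤ G.minDegree) {B : Finset (Sym2 V)}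
    (hB : 512 * B.card ≤ Fintype.card V ^ 2)
    (hz : (2 : ℝ) ^ (-((Fintype.card V : ℝ) / 256 / Q)) ≤ ((Fintype.card V : ℝ) ^ 10)⁻¹) :
    ∑ i ∈ boosterIndices V, (2 : ℝ) ^ (-(((freeBoosters G Γ₀ B i).card : ℝ) / Q)) < 1 / 2 := by
  have hQ' : (0 : ℝ) < Q := by exact_mod_cast hQ
  have hcount : (boosterIndices V).card ≤ Fintype.card V ^ (4 * Fintype.card V) := by
    have h1 := card_filter_card_le (β := Sym2 V) (Fintype.card V)
    have h2 : Fintype.card (Sym2 V) + 1 ≤ Fintype.card V ^ 2 := by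
      rw [Sym2.card, Nat.choose_two_right, Nat.add_sub_cancel]
      have h3 : (Fintype.card V + 1) * Fintype.card V =
        Fintype.card V ^ 2 + Fintype.card V := by ring
      have h4 : 64 * Fintype.card V ≤ Fintype.card V ^ 2 := by
        rw [sq]; exact Nat.mul_le_mul_right _ hk
      omega
    have h3 : (Finset.univ.filter fun p : V × V => p.1 ≠ p.2).card ≤ Fintype.card V ^ 2 := by
      refine (Finset.card_le_univ _).trans ?_
      rw [Fintype.card_prod, sq]
    rw [boosterIndices, Finset.card_product]
    calc _ ≤ (Fintype.card V ^ 2) ^ Fintype.card V * Fintype.card V ^ 2 :=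
          Nat.mul_le_mul (h1.trans (Nat.pow_le_pow_left h2 _)) h3
      _ = Fintype.card V ^ (2 * Fintype.card V + 2) := by rw [← pow_mul, ← pow_add]
      _ ≤ Fintype.card V ^ (4 * Fintype.card V) := Nat.pow_le_pow_right (by omega) (by omega)
  set k := Fintype.card V with hkdef
  set z : ℝ := (2 : ℝ) ^ (-((k : ℝ) / 256 / Q)) with hzdef
  have hk' : (64 : ℝ) ≤ k := by exact_mod_cast hk
  have hz0 : 0 < z := by positivity
  have hterm : ∀ i ∈ boosterIndices V,
      (2 : ℝ) ^ (-(((freeBoosters G Γ₀ B i).card : ℝ) / Q)) ≤ z ^ k := by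
    intro i hi
    have hi' : i.2.1 ≠ i.2.2 := by
      have := (Finset.mem_product.1 hi).2
      simpa using this
    have h1 := card_freeBoosters_ge hΓ₀ hk hdeg hB hi'
    rw [hzdef, ← Real.rpow_mul_natCast (by norm_num)]
    refine Real.rpow_le_rpow_of_exponent_le (by norm_num) ?_
    have h2 : (k : ℝ) ^ 2 / 256 / Q ≤ (freeBoosters G Γ₀ B i).card / Q := by gcongr
    calc -(((freeBoosters G Γ₀ B i).card : ℝ) / Q) ≤ -((k : ℝ) ^ 2 / 256 / Q) := neg_le_neg h2
      _ = _ := by ring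
  calc ∑ i ∈ boosterIndices V, (2 : ℝ) ^ (-(((freeBoosters G Γ₀ B i).card : ℝ) / Q))
      ≤ ∑ _i ∈ boosterIndices V, z ^ k := Finset.sum_le_sum hterm
    _ = (boosterIndices V).card * z ^ k := by rw [Finset.sum_const, nsmul_eq_mul]
    _ ≤ (k : ℝ) ^ (4 * k) * (((k : ℝ) ^ 10)⁻¹) ^ k := by
        gcongr
        exact_mod_cast hcount
    _ = (((k : ℝ) ^ 6)⁻¹) ^ k := by
        rw [pow_mul, ← mul_pow]
        congr 1
        field_simp
    _ ≤ (1 / 64) ^ k := by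
        gcongr
        rw [inv_eq_one_div]
        refine one_div_le_one_div_of_le (by norm_num) (hk'.trans ?_)
        exact le_self_pow₀ (by linarith) (by norm_num)
    _ ≤ (1 / 64) ^ 1 := pow_le_pow_of_le_one (by norm_num) (by norm_num) (by omega)
    _ < 1 / 2 := by norm_num

/-! ### Maker's strategy -/

/-- Maker makes his graph expanding within `t` turns, and then hits the boosters within `t` more
turns. The bound on `2 ^ (-k / (256 Q))` serves the Erdős–Selfridge criterion in both stages, and
`512 q t ≤ k ^ 2` keeps most of the boosters away from Breaker in the first stage. -/
theorem makerWinsWithin_of_bounds (G : SimpleGraph V) [DecidableRel G.Adj] {q Q t : ℕ}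
    (hQ : 0 < Q) (hqQ : q ≤ Q) (hk : 64 ≤ Fintype.card V)
    (hdeg : (Fintype.card V : ℝ) - Fintype.card V / 1024 ≤ G.minDegree)
    (hz : (2 : ℝ) ^ (-((Fintype.card V : ℝ) / 256 / Q)) ≤ ((Fintype.card V : ℝ) ^ 10)⁻¹)
    (ht : Fintype.card V ^ 2 ≤ t * (Q + 1)) (hqt : 512 * (q * t) ≤ Fintype.card V ^ 2) :
    MakerWinsWithin 1 q G.edgeFinset G.hamiltonConnectedEdgeSets (t + t) := by
  classical
  have hX : G.edgeFinset.card ≤ t * (Q + 1) := by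
    have h1 := G.card_edgeFinset_le_card_choose_two
    have h2 := Nat.choose_le_pow (Fintype.card V) 2
    omega
  have h1 := canReach_hitsAll hQ hqQ G.edgeFinset (expansionPairs V)
    (fun p => crossingEdges G p.1 p.2) (B := ∅) (M := ∅)
    (fun p _ => by rw [Finset.sdiff_empty]; exact Finset.filter_subset _ _) t (by simp) (by simp)
    (by simp) hX (sum_crossingEdges_lt hQ hk hdeg hz)
  refine (h1.trans (W' := fun _ M => M ∈ G.hamiltonConnectedEdgeSets) fun B M hBM => ?_)
    |>.makerWinsWithin fun B M h => ⟨M, h, subset_rfl⟩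
  obtain ⟨hhit, hBcard, hBX, hMX, hdisj⟩ := hBM
  have hB : 512 * B.card ≤ Fintype.card V ^ 2 := by
    rw [Finset.card_empty, zero_add] at hBcard
    omega
  have hΓ₀ := isExpanding_of_hits hhit
  set Γ₀ := fromEdgeSet (M : Set (Sym2 V))
  have h2 := canReach_hitsAll hQ hqQ G.edgeFinset (boosterIndices V) (freeBoosters G Γ₀ B)
    (fun i _ => Finset.filter_subset _ _) t hBX hMX hdisj hX
    (sum_freeBoosters_lt hΓ₀ hQ hk hdeg hB hz)
  refine (h2.and_subset subset_rfl).trans (t := 0) fun B' M' h => ?_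
  obtain ⟨⟨hhit', -, -, hM'X, -⟩, hMM'⟩ := h
  refine ⟨hM'X, fun u w huw => ?_⟩
  refine exists_isHamiltonian_of_boosters (Γ₀ := Γ₀)
    (fromEdgeSet_mono (Finset.coe_subset.2 hMM')) huw fun Y hY => ?_
  obtain ⟨e, he, heM'⟩ := Finset.not_disjoint_iff.1 (hhit' (Y, u, w) (by
    simp [boosterIndices, hY, huw]))
  have he' := (Finset.mem_filter.1 he).2
  refine ⟨e, ?_, he'⟩
  rw [edgeSet_fromEdgeSet]
  exact ⟨heM', he'.1⟩

end SimpleGraph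

/-! ### The choice of the parameters -/

open Filter in
theorem eventually_log_bounds :
    ∀ᶠ k : ℕ in atTop, 1024 ≤ k ∧ (2 : ℝ) ^ 24 ≤ Real.log k ∧ Real.log k ^ 2 ≤ k := by
  have h1 : Tendsto (fun k : ℕ => Real.log (k : ℝ)) atTop atTop :=
    Real.tendsto_log_atTop.comp tendsto_natCast_atTop_atTop
  have h2 := ((Real.isLittleO_pow_log_id_atTop (n := 2)).comp_tendsto
    (tendsto_natCast_atTop_atTop (R := ℝ))).bound (zero_lt_one)
  filter_upwards [eventually_ge_atTop 1024, h1.eventually_ge_atTop ((2 : ℝ) ^ 24), h2]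
    with k hk hlog hsq
  refine ⟨hk, hlog, ?_⟩
  have := (le_abs_self _).trans hsq
  simpa using this

/-- If `Q ≤ 2048 k / (log k) ^ 2`, then a set of `k / 256` elements has weight at most `k ^ (-10)`,
as soon as `log k ≥ 2 ^ 24 ≥ 10 · 256 · 2048 / log 2`. -/
theorem two_rpow_neg_le {k Q : ℕ} (hk : 0 < k) (hQ : 0 < Q) (hlog : (2 : ℝ) ^ 24 ≤ Real.log k)
    (hQle : (Q : ℝ) ≤ 2048 * (k / Real.log k ^ 2)) :
    (2 : ℝ) ^ (-((k : ℝ) / 256 / Q)) ≤ ((k : ℝ) ^ 10)⁻¹ := by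
  have hk' : (0 : ℝ) < k := by exact_mod_cast hk
  have hQ' : (0 : ℝ) < Q := by exact_mod_cast hQ
  set L := Real.log k with hL
  have hL0 : 0 < L := lt_of_lt_of_le (by norm_num) hlog
  have hpow : ((k : ℝ) ^ 10)⁻¹ = Real.exp (-(10 * L)) := by
    rw [Real.exp_neg, hL, show (10 : ℝ) * Real.log k = ((10 : ℕ) : ℝ) * Real.log k by norm_num,
      Real.exp_nat_mul, Real.exp_log hk']
  rw [hpow, Real.rpow_def_of_pos (by norm_num)]
  refine Real.exp_le_exp.2 ?_
  have h1 : L ^ 2 / (256 * 2048) ≤ (k : ℝ) / 256 / Q := by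
    rw [le_div_iff₀ hQ']
    calc L ^ 2 / (256 * 2048) * (Q : ℝ) ≤ L ^ 2 / (256 * 2048) * (2048 * (k / L ^ 2)) := by gcongr
      _ = (k : ℝ) / 256 := by field_simp
  have h2 : (1 / 2 : ℝ) ≤ Real.log 2 := by linarith [Real.log_two_gt_d9]
  have h3 : 10 * L ≤ 1 / 2 * (L ^ 2 / (256 * 2048)) := by
    rw [sq]
    have : (2 : ℝ) ^ 24 * L ≤ L * L := mul_le_mul_of_nonneg_right hlog hL0.le
    linarith
  have h4 : 1 / 2 * (L ^ 2 / (256 * 2048)) ≤ Real.log 2 * ((k : ℝ) / 256 / Q) := by gcongr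
  linarith

theorem proposition2p8 :
    ∃ C : ℝ, 0 < C ∧
      ∀ g : ℕ → ℝ,
        g =o[Filter.atTop] (fun k : ℕ => (k : ℝ) / Real.log (k : ℝ)) →
        ∃ k₀ : ℕ, ∀ k : ℕ, k₀ ≤ k →
          ∀ q : ℕ, (q : ℝ) ≤ (k : ℝ) / Real.log (k : ℝ) ^ 2 →
          ∀ (V : Type*) [Fintype V] [DecidableEq V] (G : SimpleGraph V) [DecidableRel G.Adj],
            Fintype.card V = k →
            (k : ℝ) - g k ≤ (G.minDegree : ℝ) →
            ∃ t : ℕ, (t : ℝ) ≤ C * ((k : ℝ) * Real.log (k : ℝ) ^ 2) ∧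
              MakerBreaker.MakerWinsWithin 1 q G.edgeFinset G.hamiltonConnectedEdgeSets t := by
  refine ⟨1, one_pos, fun g hg => ?_⟩
  obtain ⟨k₀, hk₀⟩ := Filter.eventually_atTop.1
    (eventually_log_bounds.and (hg.bound (show (0 : ℝ) < 1 / 1024 by norm_num)))
  refine ⟨k₀, fun k hk q hq V _ _ G _ hV hdeg => ?_⟩
  obtain ⟨⟨hk1024, hlog, hsq⟩, hgk⟩ := hk₀ k hk
  have hkR : (1024 : ℝ) ≤ k := by exact_mod_cast hk1024
  set L := Real.log k with hL
  have hL1 : 1 ≤ L := le_trans (by norm_num) hlog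
  have hL2 : 1 ≤ L ^ 2 := one_le_pow₀ hL1
  set r : ℝ := k / L ^ 2 with hr
  have hr1 : 1 ≤ r := by rwa [hr, le_div_iff₀ (by linarith), one_mul]
  have hrk : r ≤ k := div_le_self (by linarith) hL2
  set Q := ⌈1024 * r⌉₊ with hQdef
  have hQge : 1024 * r ≤ Q := Nat.le_ceil _
  have hQle : (Q : ℝ) ≤ 2048 * r := by
    have := (Nat.ceil_lt_add_one (show 0 ≤ 1024 * r by linarith)).le
    linarith
  have hQ0 : 0 < Q := by
    have : (0 : ℝ) < Q := by linarith
    exact_mod_cast this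
  have hQR : (0 : ℝ) < Q := by exact_mod_cast hQ0
  have hqQ : q ≤ Q := by
    have : (q : ℝ) ≤ Q := by linarith
    exact_mod_cast this
  have hgle : g k ≤ k / 1024 := by
    have h1 : ‖(k : ℝ) / L‖ ≤ k := by
      rw [Real.norm_of_nonneg (by positivity)]
      exact div_le_self (by linarith) hL1
    have h2 := (le_abs_self _).trans hgk
    linarith
  -- this many rounds use up all edges when Breaker takes `Q` edges per round
  set t := ⌈(k : ℝ) ^ 2 / Q⌉₊ with htdef
  have htge : (k : ℝ) ^ 2 ≤ t * Q := (div_le_iff₀ hQR).1 (Nat.le_ceil _)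
  have htle : (t : ℝ) ≤ k * L ^ 2 / 1024 + 1 := by
    have h1 := (Nat.ceil_lt_add_one (show 0 ≤ (k : ℝ) ^ 2 / Q by positivity)).le
    have h2 : (k : ℝ) ^ 2 / Q ≤ (k : ℝ) ^ 2 / (1024 * r) := by gcongr
    have h3 : (k : ℝ) ^ 2 / (1024 * r) = k * L ^ 2 / 1024 := by
      rw [hr]
      field_simp
    linarith
  have hkL : (1024 : ℝ) ≤ k * L ^ 2 := 
    hkR.trans (le_mul_of_one_le_right (by linarith) hL2)
  refine ⟨t + t, ?_, G.makerWinsWithin_of_bounds hQ0 hqQ (by omega) ?_ ?_ ?_ ?_⟩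
  · push_cast
    linarith
  · rw [hV]
    linarith
  · rw [hV]
    exact two_rpow_neg_le (by omega) hQ0 hlog hQle
  · rw [hV]
    have : k ^ 2 ≤ t * Q := by exact_mod_cast htge
    exact this.trans (Nat.mul_le_mul_left _ (Nat.le_succ _))
  · rw [hV]
    have h1 : (q : ℝ) * t ≤ r * (k * L ^ 2 / 1024 + 1) := by gcongr
    have h2 : r * (k * L ^ 2 / 1024 + 1) = (k : ℝ) ^ 2 / 1024 + r := by
      rw [hr]
      field_simp
    have h3 : (1024 : ℝ) * k ≤ k ^ 2 := by
      rw [sq]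
      exact mul_le_mul_of_nonneg_right hkR (by linarith)
    have h4 : 512 * ((q : ℝ) * t) ≤ (k : ℝ) ^ 2 := by linarith
    exact_mod_cast h4
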